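/- Let $k$ be a (unital, associative) ring and let $X$ be a connected and locally simply connected topological space: every point has a basis of open neighbourhoods that are simply connected, where a space is called simply connected if it is connected and each of its coverings is trivial. Let $\operatorname{Shv}_k(X)$ be the category of sheaves of $k$-modules on $X$, and let $i\colon\operatorname{Qcoh}_k(X)\hookrightarrow\operatorname{Shv}_k(X)$ be the inclusion of the full subcategory of quasi-coherent sheaves, i.e. of the sheaves $F$ such that every point has an open neighbourhood $U$ with an exact sequence $k_U^{\oplus I}\to k_U^{\oplus J}\to F|_U\to 0$, where $k_U$ is the constant sheaf and $I,J$ are arbitrary sets. Then $\operatorname{Qcoh}_k(X)$ is an abelian subcategory of $\operatorname{Shv}_k(X)$ (it contains $0$ and is closed under finite products, kernels and cokernels), it has enough injectives, and $i$ has a right adjoint $\operatorname{Qc}\colon\operatorname{Shv}_k(X)\to\operatorname{Qcoh}_k(X)$. Write $D^+(X)$, $D^+(\operatorname{Qcoh}_k(X))$, $D^+(k)$ for the bounded below derived categories of $\operatorname{Shv}_k(X)$, $\operatorname{Qcoh}_k(X)$ and of $k$-modules. Let $$\mathbb R\Gamma\colon D^+(X)\to D^+(k),\qquad \mathbb R_{\rm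 qc}\Gamma\colon D^+(\operatorname{Qcoh}_k(X))\to D^+(k),\qquad \mathbb R\operatorname{Qc}\colon D^+(X)\to D^+(\operatorname{Qcoh}_k(X))$$ be the right derived functors of $\Gamma(X,-)$ on $\operatorname{Shv}_k(X)$, of $\Gamma(X,-)$ restricted to $\operatorname{Qcoh}_k(X)$, and of $\operatorname{Qc}$. Put $H^n(X,F)=H^n(\mathbb R\Gamma F)$ and $R^q\operatorname{Qc}(F)=H^q(\mathbb R\operatorname{Qc}F)$ for $F\in D^+(X)$, and $H^n_{\rm qc}(X,\mathcal L)=H^n(\mathbb R_{\rm qc}\Gamma\,\mathcal L)$ for a quasi-coherent sheaf $\mathcal L$, placed in degree $0$. (1) The counit $i\operatorname{Qc}(F)\to F$ of the adjunction induces an isomorphism $\Gamma(X,\operatorname{Qc}(F))\cong\Gamma(X,F)$, natural in $F\in\operatorname{Shv}_k(X)$, and there is an isomorphism of functors $D^+(X)\to D^+(k)$, $$\mathbb R\Gamma\;\simeq\;\mathbb R_{\rm qc}\Gamma\circ\mathbb R\operatorname{Qc},$$ compatible with it: for every bounded below complex $K$ of sheaves, the composite $\Gamma(X,K)\to\mathbb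 R\Gamma(K)\simeq\mathbb R_{\rm qc}\Gamma(\mathbb R\operatorname{Qc}(K))$ equals the composite $\Gamma(X,K)\cong\Gamma(X,\operatorname{Qc}(K))\to\mathbb R_{\rm qc}\Gamma(\operatorname{Qc}(K))\to\mathbb R_{\rm qc}\Gamma(\mathbb R\operatorname{Qc}(K))$ in $D^+(k)$, the unnamed arrows being induced by the canonical morphisms to the derived functors. (2) For every $F\in D^+(X)$ there is a convergent spectral sequence $$E_2^{p,q}=H^p_{\rm qc}(X,R^q\operatorname{Qc}(F))\;\Rightarrow\;H^{p+q}(X,F)\qquad(p,q\in\mathbb Z),$$ that is, a cohomological $E_2$-spectral sequence of $k$-modules with these terms such that for every $(p,q)$ the differentials to and from $E_r^{p,q}$ vanish for all large $r$, and every $H^n(X,F)$ carries a finite decreasing filtration with $E_\infty^{p,q}\cong F^pH^{p+q}(X,F)/F^{p+1}H^{p+q}(X,F)$. -/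

import Mathlib

open CategoryTheory CategoryTheory.Limits TopologicalSpace Opposite

universe w₁ w₂ w₃ v u

noncomputable section

/-- A space is simply connected if it is connected and every covering of it is trivial, i.e.
isomorphic over the space to the projection from a product with a discrete space. -/
def IsSimplyConnectedSpace (S : Type u) [TopologicalSpace S] : Prop :=
  ConnectedSpace S ∧
    ∀ (E : Type u) [TopologicalSpace E] (p : E → S), IsCoveringMap p →
      ∃ (I : Type u) (_ : TopologicalSpace I) (_ : DiscreteTopology I) (h : E ≃ₜ S × I),
        ∀ e : E, (h e).1 = p e

/-- A space is locally simply connected if every point has a basis of simply connected open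
neighbourhoods. -/
def IsLocallySimplyConnectedSpace (S : Type u) [TopologicalSpace S] : Prop :=
  ∀ (x : S) (U : Opens S), x ∈ U →
    ∃ V : Opens S, x ∈ V ∧ V ≤ U ∧ IsSimplyConnectedSpace V

section Sheaves

variable (k : Type u) [Ring k] (X : TopCat.{u})

/-- The category of sheaves of `k`-modules on `X`. -/
abbrev Shv : Type (u + 1) := TopCat.Sheaf (ModuleCat.{u} k) X

/-- The constant sheaf `k_X`. -/
def constSheaf : Shv k X :=
  (constantSheaf (Opens.grothendieckTopology X) (ModuleCat.{u} k)).obj (ModuleCat.of k k)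

/-- The free sheaf `k_X^{⊕ I}`. -/
def freeSheaf (I : Type u) : Shv k X := ∐ fun _ : I => constSheaf k X

variable {k X} in
/-- The restriction of a sheaf to an open subspace. -/
def restrictSheaf (F : Shv k X) (U : Opens X) : Shv k (TopCat.of U) :=
  U.sheafRestrict.obj F

/-- A sheaf is quasi-coherent if each point has an open neighbourhood `U` with an exact sequence
`k_U^{⊕ I} ⟶ k_U^{⊕ J} ⟶ F|_U ⟶ 0`. -/
def isQuasicoherentSheaf : ObjectProperty (Shv k X) := fun F =>
  ∀ x : X, ∃ (U : Opens X) (_ : x ∈ U) (I J : Type u)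
    (f : freeSheaf k (TopCat.of U) I ⟶ freeSheaf k (TopCat.of U) J)
    (g : freeSheaf k (TopCat.of U) J ⟶ restrictSheaf F U) (zero : f ≫ g = 0),
    (ShortComplex.mk f g zero).Exact ∧ Epi g

/-- The full subcategory of quasi-coherent sheaves. -/
abbrev Qcoh : Type (u + 1) := (isQuasicoherentSheaf k X).FullSubcategory

/-- The inclusion functor of quasi-coherent sheaves into all sheaves. -/
abbrev qcohInclusion : Qcoh k X ⥤ Shv k X := (isQuasicoherentSheaf k X).ι

/-- The global sections functor `Γ(X, -)` on all sheaves. -/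
def globalSections : Shv k X ⥤ ModuleCat.{u} k :=
  (sheafSections (Opens.grothendieckTopology X) (ModuleCat.{u} k)).obj (op ⊤)

instance : (globalSections k X).Additive where
  map_add := rfl

/-- The global sections functor `Γ(X, -)` on quasi-coherent sheaves. -/
abbrev qcGlobalSections : Qcoh k X ⥤ ModuleCat.{u} k := qcohInclusion k X ⋙ globalSections k X

end Sheaves

/-- A full subcategory of an abelian category is an abelian subcategory if it contains zero and is
closed under finite products, kernels and cokernels. Such a subcategory is itself abelian, and its
inclusion is exact. -/
class IsAbelianSubcategory {C : Type u} [Category.{v} C] [Abelian C] (P : ObjectProperty C) :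
    Prop extends P.ContainsZero, P.IsClosedUnderFiniteProducts, P.IsClosedUnderKernels,
      P.IsClosedUnderCokernels

section Derived

variable (k : Type u) [Ring k] (X : TopCat.{u})

/-- The quasicoherator: the right adjoint of the inclusion of quasi-coherent sheaves. -/
def quasicoherator [(qcohInclusion k X).IsLeftAdjoint] : Shv k X ⥤ Qcoh k X :=
  (qcohInclusion k X).rightAdjoint

/-- The adjunction between the inclusion of quasi-coherent sheaves and the quasicoherator. -/
def quasicoheratorAdj [(qcohInclusion k X).IsLeftAdjoint] :
    qcohInclusion k X ⊣ quasicoherator k X :=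
  Adjunction.ofIsLeftAdjoint (qcohInclusion k X)

instance [IsAbelianSubcategory (isQuasicoherentSheaf k X)] [(qcohInclusion k X).IsLeftAdjoint] :
    (quasicoherator k X).Additive :=
  (quasicoheratorAdj k X).right_adjoint_additive

/-- The right derived functor `RΓ : D⁺(X) ⥤ D⁺(k)` of `Γ(X, -)` on all sheaves. -/
abbrev RΓ [HasDerivedCategory.{w₁} (Shv k X)] [HasDerivedCategory.{w₂} (ModuleCat.{u} k)] :
    DerivedCategory.Plus (Shv k X) ⥤ DerivedCategory.Plus (ModuleCat.{u} k) :=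
  (globalSections k X).rightDerivedFunctorPlus

variable [IsAbelianSubcategory (isQuasicoherentSheaf k X)]

/-- The right derived functor `R_qcΓ : D⁺(Qcoh(X)) ⥤ D⁺(k)` of `Γ(X, -)` on quasi-coherent
sheaves. -/
abbrev RqcΓ [EnoughInjectives (Qcoh k X)]
    [HasDerivedCategory.{w₃} (Qcoh k X)] [HasDerivedCategory.{w₂} (ModuleCat.{u} k)] :
    DerivedCategory.Plus (Qcoh k X) ⥤ DerivedCategory.Plus (ModuleCat.{u} k) :=
  (qcGlobalSections k X).rightDerivedFunctorPlus

/-- The right derived functor `RQc : D⁺(X) ⥤ D⁺(Qcoh(X))` of the quasicoherator. -/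
abbrev RQc [(qcohInclusion k X).IsLeftAdjoint]
    [HasDerivedCategory.{w₁} (Shv k X)] [HasDerivedCategory.{w₃} (Qcoh k X)] :
    DerivedCategory.Plus (Shv k X) ⥤ DerivedCategory.Plus (Qcoh k X) :=
  (quasicoherator k X).rightDerivedFunctorPlus

/-- The cohomology modules `Hⁿ(X, F)` of `F` in `D⁺(X)`. -/
abbrev sheafCohomology [HasDerivedCategory.{w₁} (Shv k X)]
    [HasDerivedCategory.{w₂} (ModuleCat.{u} k)]
    (n : ℤ) (F : DerivedCategory.Plus (Shv k X)) : ModuleCat.{u} k :=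
  (DerivedCategory.Plus.homologyFunctor (ModuleCat.{u} k) n).obj ((RΓ k X).obj F)

/-- The quasi-coherent cohomology modules `Hⁿ_qc(X, L)` of a quasi-coherent sheaf `L`, regarded as
a complex concentrated in degree `0`. -/
abbrev qcCohomology [EnoughInjectives (Qcoh k X)]
    [HasDerivedCategory.{w₃} (Qcoh k X)] [HasDerivedCategory.{w₂} (ModuleCat.{u} k)]
    (n : ℤ) (L : Qcoh k X) : ModuleCat.{u} k :=
  (DerivedCategory.Plus.homologyFunctor (ModuleCat.{u} k) n).obj
    ((RqcΓ k X).obj ((DerivedCategory.Plus.singleFunctor (Qcoh k X) 0).obj L))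

/-- The quasi-coherent sheaf `R^q Qc (F)`, for `F` in `D⁺(X)`. -/
abbrev derivedQc [(qcohInclusion k X).IsLeftAdjoint]
    [HasDerivedCategory.{w₁} (Shv k X)] [HasDerivedCategory.{w₃} (Qcoh k X)]
    (q : ℤ) (F : DerivedCategory.Plus (Shv k X)) : Qcoh k X :=
  (DerivedCategory.Plus.homologyFunctor (Qcoh k X) q).obj ((RQc k X).obj F)

end Derived

/-- Convergence of a cohomological `E₂`-spectral sequence `E` to a graded object `H`: each `H n`
carries a finite decreasing filtration, for each position `(p, q)` the differentials to and from
`(p, q)` vanish from some page on, and the object at `(p, q)` of that page (hence of all later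
ones), i.e. the object `E_∞^{p,q}`, is isomorphic to the `p`-th graded piece of `H (p + q)`. -/
structure SpectralSequenceConvergence {C : Type u} [Category.{v} C] [Abelian C]
    (E : E₂CohomologicalSpectralSequence C) (H : ℤ → C) where
  /-- the filtration, `fil n p` being the `p`-th step of the filtration of `H n` -/
  fil (n p : ℤ) : Subobject (H n)
  fil_succ_le (n p : ℤ) : fil n (p + 1) ≤ fil n p
  exists_eq_top (n : ℤ) : ∃ p, fil n p = ⊤
  exists_eq_bot (n : ℤ) : ∃ p, fil n p = ⊥
  /-- a page from which on the object at `(p, q)` is stationary -/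
  stage (p q : ℤ) : ℤ
  two_le_stage (p q : ℤ) : 2 ≤ stage p q
  d_from_eq_zero (p q r : ℤ) (hr : stage p q ≤ r) (pq' : ℤ × ℤ) :
    (E.page r ((two_le_stage p q).trans hr)).d (p, q) pq' = 0
  d_to_eq_zero (p q r : ℤ) (hr : stage p q ≤ r) (pq' : ℤ × ℤ) :
    (E.page r ((two_le_stage p q).trans hr)).d pq' (p, q) = 0
  /-- `E_∞^{p,q}` is the `p`-th graded piece of the filtration of `H (p + q)` -/
  iso (p q : ℤ) :
    (E.page (stage p q) (two_le_stage p q)).X (p, q) ≅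
      cokernel (Subobject.ofLE (fil (p + q) (p + 1)) (fil (p + q) p) (fil_succ_le (p + q) p))

end

/-! Over a connected open set, a cokernel of a map of constant sheaves is constant, so a
quasi-coherent sheaf is locally constant. Its étale space is then a covering, trivial over every
simply connected open set, and the sheaf is constant there. Conversely, a constant sheaf with fibre
`M` inherits a free presentation from `M`. Hence a sheaf is quasi-coherent exactly when its
restriction maps between simply connected open sets are bijective (`isQuasicoherentSheaf_iff`).

Everything about the category follows from this criterion. Sections commute with limits, which gives
kernels and products; cokernels are handled by `IsConstantOn.of_exact`. Sheaves embed fully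
faithfully into presheaves on the basis of simply connected open sets, and the quasi-coherent ones
become the presheaves inverting every arrow, that is, the functors on a localization. Right Kan
extension along the localization functor gives the right adjoint Qc (`isLeftAdjoint_qcohInclusion`).

Since Γ is Hom(k_X, -) and k_X is quasi-coherent, the counit is an isomorphism on global sections.
The inclusion preserves monomorphisms, so Qc preserves injectives, and the derived functor of the
composite is the composite of the derived functors. The spectral sequence is that of the truncations
of RQc(F): the derived functor of Γ on quasi-coherent sheaves, followed by cohomology, turns them
into a spectral object whose vanishing for low indices and low degrees forces convergence. -/

/-! ### Sheaves constant on a connected open set -/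

section ConstantOn

variable {k : Type u} [Ring k] {X : TopCat.{u}}

/-- The restriction map of a sheaf of modules, as a linear map. -/
def sheafRes (F : Shv k X) {V U : Opens X} (h : V ≤ U) :
    F.obj.obj (op U) →ₗ[k] F.obj.obj (op V) :=
  (F.obj.map (homOfLE h).op).hom

lemma sheafRes_sheafRes (F : Shv k X) {W V U : Opens X} (h : W ≤ V) (h' : V ≤ U)
    (s : F.obj.obj (op U)) :
    sheafRes F h (sheafRes F h' s) = sheafRes F (h.trans h') s := by
  have : (homOfLE (h.trans h')).op = (homOfLE h').op ≫ (homOfLE h).op := rfl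
  simp [sheafRes, this]

lemma sheafRes_naturality {F G : Shv k X} (f : F ⟶ G) {V U : Opens X} (h : V ≤ U)
    (s : F.obj.obj (op U)) :
    sheafRes G h ((f.hom.app (op U)).hom s) = (f.hom.app (op V)).hom (sheafRes F h s) :=
  (NatTrans.naturality_apply f.hom (homOfLE h).op s).symm

lemma eq_of_locally_sheafRes_eq (F : Shv k X) {U : Opens X} (s t : F.obj.obj (op U))
    (h : ∀ x ∈ U, ∃ (V : Opens X) (hV : V ≤ U), x ∈ V ∧ sheafRes F hV s = sheafRes F hV t) :
    s = t := by
  choose V hV hx hst using fun x : U => h x.1 x.2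
  exact F.eq_of_locally_eq' V U (fun x => homOfLE (hV x))
    (fun x hxU => Opens.mem_iSup.2 ⟨⟨x, hxU⟩, hx ⟨x, hxU⟩⟩) s t hst

lemma exists_sheafRes_eq_of_compatible (F : Shv k X) {U : Opens X} (V : U → Opens X)
    (hV : ∀ x, V x ≤ U) (hx : ∀ x : U, x.1 ∈ V x) (s : ∀ x, F.obj.obj (op (V x)))
    (hs : ∀ x y, sheafRes F (inf_le_left : V x ⊓ V y ≤ _) (s x) =
      sheafRes F (inf_le_right : V x ⊓ V y ≤ _) (s y)) :
    ∃ t : F.obj.obj (op U), ∀ x, sheafRes F (hV x) t = s x := by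
  obtain ⟨t, ht, -⟩ := F.existsUnique_gluing' V U (fun x => homOfLE (hV x))
    (fun x hxU => Opens.mem_iSup.2 ⟨⟨x, hxU⟩, hx ⟨x, hxU⟩⟩) s (fun x y => hs x y)
  exact ⟨t, ht⟩

/-- A sheaf is constant on an open set `U` if its sections over `U` restrict injectively to all
nonempty open subsets, and if all local sections locally extend to `U`. -/
structure IsConstantOn (F : Shv k X) (U : Opens X) : Prop where
  injective {W : Opens X} (h : W ≤ U) (hW : (W : Set X).Nonempty) :
    Function.Injective (sheafRes F h)
  exists_extension {W : Opens X} (h : W ≤ U) (s : F.obj.obj (op W)) {x : X} (hx : x ∈ W) :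
    ∃ (W' : Opens X) (h' : W' ≤ W) (m : F.obj.obj (op U)), x ∈ W' ∧
      sheafRes F h' s = sheafRes F (h'.trans h) m

/-- It suffices to test a family of sections over `U`, because such a family is automatically
exhaustive: the member agreeing with a given section near `x` is locally constant in `x`, hence
constant on the connected `U`. -/
lemma IsConstantOn.of_family (F : Shv k X) {U : Opens X} (hU : IsConnected (U : Set X))
    {M : Type*} (φ : M → F.obj.obj (op U))
    (inj : ∀ {W : Opens X} (h : W ≤ U), (W : Set X).Nonempty → ∀ m m' : M,
      sheafRes F h (φ m) = sheafRes F h (φ m') → φ m = φ m')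
    (surj : ∀ {W : Opens X} (h : W ≤ U) (s : F.obj.obj (op W)) {x : X}, x ∈ W →
      ∃ (W' : Opens X) (h' : W' ≤ W) (m : M), x ∈ W' ∧
        sheafRes F h' s = sheafRes F (h'.trans h) (φ m)) :
    IsConstantOn F U := by
  have key : Function.Surjective φ := by
    intro s
    choose W hWU m hxW hm using fun x : U => surj le_rfl s x.2
    obtain ⟨x₀, hx₀⟩ := hU.nonempty
    have : PreconnectedSpace U := Subtype.preconnectedSpace hU.isPreconnected
    have hc : IsLocallyConstant fun x => φ (m x) := by
      rw [IsLocallyConstant.iff_exists_open]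
      intro x
      refine ⟨Subtype.val ⁻¹' (W x : Set X), (W x).isOpen.preimage continuous_subtype_val,
        hxW x, fun y hy => ?_⟩
      refine inj (W := W y ⊓ W x) (inf_le_left.trans (hWU y)) ⟨y.1, hxW y, hy⟩ _ _ ?_
      have h₁ := congr(sheafRes F (inf_le_left : W y ⊓ W x ≤ _) $(hm y))
      have h₂ := congr(sheafRes F (inf_le_right : W y ⊓ W x ≤ _) $(hm x))
      rw [sheafRes_sheafRes, sheafRes_sheafRes] at h₁ h₂
      exact h₁.symm.trans h₂
    refine ⟨m ⟨x₀, hx₀⟩, eq_of_locally_sheafRes_eq F _ _ fun x hx => ⟨W ⟨x, hx⟩,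
      hWU ⟨x, hx⟩, hxW ⟨x, hx⟩, ?_⟩⟩
    exact congr(sheafRes F _ $(hc.apply_eq_of_preconnectedSpace ⟨x₀, hx₀⟩ ⟨x, hx⟩)).trans
      (hm ⟨x, hx⟩).symm
  refine ⟨fun h hW s t hst => ?_, fun h s x hx => ?_⟩
  · obtain ⟨m, rfl⟩ := key s
    obtain ⟨m', rfl⟩ := key t
    exact inj h hW _ _ hst
  · obtain ⟨W', h', m, hx, e⟩ := surj h s hx
    exact ⟨W', h', φ m, hx, e⟩

lemma IsConstantOn.mono {F : Shv k X} {U V : Opens X} (hF : IsConstantOn F U) (h : V ≤ U)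
    (hV : IsConnected (V : Set X)) : IsConstantOn F V := by
  refine .of_family F hV (sheafRes F h) (fun {W} hW hne m m' e => ?_) fun {W} hW s {x} hx => ?_
  · rw [sheafRes_sheafRes, sheafRes_sheafRes] at e
    rw [hF.injective _ hne e]
  · obtain ⟨W', h', m, hx', e⟩ := hF.exists_extension (hW.trans h) s hx
    exact ⟨W', h', m, hx', by rw [e, sheafRes_sheafRes]⟩

lemma IsConstantOn.bijective {F : Shv k X} {U V : Opens X} (hF : IsConstantOn F U) (h : V ≤ U)
    (hV : IsConnected (V : Set X)) : Function.Bijective (sheafRes F h) := by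
  refine ⟨hF.injective h hV.nonempty, fun s => ?_⟩
  obtain ⟨x, hx⟩ := hV.nonempty
  obtain ⟨W', h', m, hx', e⟩ := hF.exists_extension h s hx
  refine ⟨m, (hF.mono h hV).injective h' ⟨x, hx'⟩ ?_⟩
  rw [sheafRes_sheafRes, e]

lemma exists_locally_preimage {F G : Shv k X} (f : F ⟶ G) [Epi f] {U : Opens X}
    (s : G.obj.obj (op U)) {x : X} (hx : x ∈ U) :
    ∃ (V : Opens X) (h : V ≤ U) (t : F.obj.obj (op V)), x ∈ V ∧
      (f.hom.app (op V)).hom t = sheafRes G h s := by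
  have hf : Sheaf.IsLocallySurjective f := (Sheaf.isLocallySurjective_iff_epi' (ModuleCat.{u} k) f).2 ‹Epi f›
  obtain ⟨V, i, ⟨t, ht⟩, hxV⟩ := hf.imageSieve_mem s x hx
  exact ⟨V, i.le, t, hxV, ht⟩

variable (k) in
/-- The functor of sections over an open set. -/
noncomputable def sheafEval (U : Opens X) : Shv k X ⥤ ModuleCat.{u} k :=
  sheafToPresheaf _ _ ⋙ (evaluation (Opens X)ᵒᵖ (ModuleCat.{u} k)).obj (op U)

instance (U : Opens X) : (sheafEval k U).Additive where
  map_add := rfl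

instance (U : Opens X) (K : Type*) [Category* K] [HasLimitsOfShape K (ModuleCat.{u} k)] :
    PreservesLimitsOfShape K (sheafEval k U) :=
  inferInstanceAs (PreservesLimitsOfShape K
    (sheafToPresheaf (Opens.grothendieckTopology X) (ModuleCat.{u} k) ⋙
      (evaluation (Opens X)ᵒᵖ (ModuleCat.{u} k)).obj (op U)))

lemma exists_locally_preimage_of_exact {F G H : Shv k X} (f : F ⟶ G) (g : G ⟶ H)
    (zero : f ≫ g = 0) (hfg : (ShortComplex.mk f g zero).Exact) {U : Opens X}
    (s : G.obj.obj (op U)) (hs : (g.hom.app (op U)).hom s = 0) {x : X} (hx : x ∈ U) :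
    ∃ (V : Opens X) (h : V ≤ U) (t : F.obj.obj (op V)), x ∈ V ∧
      (f.hom.app (op V)).hom t = sheafRes G h s := by
  have : Epi (kernel.lift g f zero) := hfg.epi_kernelLift
  have ex : (ShortComplex.mk (kernel.ι g) g (kernel.condition g)).Exact :=
    ShortComplex.exact_of_f_is_kernel _ (kernelIsKernel g)
  have ex' := ex.map_of_mono_of_preservesKernel (sheafEval k U) inferInstance inferInstance
  obtain ⟨s', hs'⟩ := (ShortComplex.moduleCat_exact_iff _).1 ex' s hs
  obtain ⟨V, h, t, hx, ht⟩ := exists_locally_preimage (kernel.lift g f zero) s' hx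
  refine ⟨V, h, t, hx, ?_⟩
  rw [← hs']
  refine Eq.trans ?_ (sheafRes_naturality (kernel.ι g) h s').symm
  rw [← ht]
  conv_lhs => rw [← kernel.lift_ι g f zero]
  rfl

/-- The cokernel of a morphism of constant sheaves is constant. -/
lemma IsConstantOn.of_exact {F G H : Shv k X} (f : F ⟶ G) (g : G ⟶ H)
    (zero : f ≫ g = 0) (hfg : (ShortComplex.mk f g zero).Exact) [Epi g] {U : Opens X}
    (hU : IsConnected (U : Set X)) (hF : IsConstantOn F U) (hG : IsConstantOn G U) :
    IsConstantOn H U := by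
  refine .of_family H hU (g.hom.app (op U)).hom (fun {W} hW hne m m' e => ?_)
    fun {W} hW s {x} hx => ?_
  · obtain ⟨x, hx⟩ := hne
    have hd : (g.hom.app (op W)).hom (sheafRes G hW (m - m')) = 0 := by
      rw [← sheafRes_naturality, map_sub, map_sub, e, sub_self]
    obtain ⟨V, h, a, hxV, ha⟩ := exists_locally_preimage_of_exact f g zero hfg _ hd hx
    obtain ⟨V', h', a', hxV', ha'⟩ := hF.exists_extension (h.trans hW) a hxV
    -- The local preimage of `m - m'` extends to `U`, and constancy of `G` spreads the equality from
    -- the nonempty `V'` to all of `U`.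
    have : m - m' = (f.hom.app (op U)).hom a' := by
      refine hG.injective (h'.trans (h.trans hW)) ⟨x, hxV'⟩ ?_
      rw [sheafRes_naturality, ← ha', ← sheafRes_naturality, ha, sheafRes_sheafRes,
        sheafRes_sheafRes]
    rw [← sub_eq_zero, ← map_sub, this]
    exact congr((($zero).hom.app (op U)).hom a')
  · obtain ⟨V, h, b, hxV, hb⟩ := exists_locally_preimage g s hx
    obtain ⟨V', h', b', hxV', hb'⟩ := hG.exists_extension (h.trans hW) b hxV
    refine ⟨V', h'.trans h, b', hxV', ?_⟩
    rw [sheafRes_naturality, ← hb', ← sheafRes_naturality, hb, sheafRes_sheafRes]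

lemma IsConstantOn.of_iso {F G : Shv k X} (e : F ≅ G) {U : Opens X} 
    (hU : IsConnected (U : Set X)) (hF : IsConstantOn F U) : IsConstantOn G U := by
  refine .of_exact (0 : F ⟶ F) e.hom zero_comp ?_ hU hF hF
  rw [ShortComplex.exact_iff_mono _ rfl]
  infer_instance

/-- The unit of sheafification is locally bijective, and restriction in the constant presheaf is the
identity, so the elements of `M` form a family as in `IsConstantOn.of_family`. -/
lemma isConstantOn_constantSheaf (M : ModuleCat.{u} k) {U : Opens X}
    (hU : IsConnected (U : Set X)) :
    IsConstantOn ((constantSheaf (Opens.grothendieckTopology X) (ModuleCat.{u} k)).obj M) U := by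
  let J := Opens.grothendieckTopology X
  let P : (Opens X)ᵒᵖ ⥤ ModuleCat.{u} k := (Functor.const _).obj M
  let F : Shv k X := (presheafToSheaf J _).obj P
  let η : P ⟶ F.obj := CategoryTheory.toSheafify J P
  change IsConstantOn F U
  have h1 : Presheaf.IsLocallyInjective J η := inferInstance
  have h2 : Presheaf.IsLocallySurjective J η := inferInstance
  have hη {V : Opens X} (h : V ≤ U) (m : M) :
      sheafRes F h ((η.app (op U)).hom m) = (η.app (op V)).hom m :=
    (NatTrans.naturality_apply η (homOfLE h).op m).symm
  refine .of_family F hU (fun m : M => (η.app (op U)).hom m) (fun {W} hW hne m m' e => ?_)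
    fun {W} hW s {x} hx => ?_
  · rw [hη, hη] at e
    obtain ⟨x, hx⟩ := hne
    obtain ⟨V, i, hV, -⟩ := Presheaf.equalizerSieve_mem J η (X := op W) m m' e x hx
    have : m = m' := hV
    rw [this]
  · obtain ⟨V, i, ⟨t, ht⟩, hxV⟩ := Presheaf.imageSieve_mem J η s x hx
    exact ⟨V, i.le, t, hxV, ht.symm.trans (hη _ _).symm⟩

lemma germ_bijective {F : Shv k X} {U : Opens X} (hF : IsConstantOn F U) (x : X) (hx : x ∈ U) :
    Function.Bijective (F.presheaf.germ U x hx) := by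
  constructor
  · intro s t h
    obtain ⟨W, hxW, i, j, e⟩ := F.presheaf.germ_eq x hx hx s t h
    exact hF.injective i.le ⟨x, hxW⟩ e
  · intro g
    obtain ⟨W, hxW, s, rfl⟩ := F.presheaf.exists_germ_eq g
    obtain ⟨V, h, m, hxV, e⟩ := hF.exists_extension (inf_le_right : W ⊓ U ≤ U)
      (sheafRes F inf_le_left s) (x := x) ⟨hxW, hx⟩
    rw [sheafRes_sheafRes] at e
    refine ⟨m, ?_⟩
    have h1 := F.presheaf.germ_res_apply (homOfLE (h.trans inf_le_right)) x hxV m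
    have h2 := F.presheaf.germ_res_apply (homOfLE (h.trans inf_le_left)) x hxV s
    exact h1.symm.trans (congr(F.presheaf.germ V x hxV $e).symm.trans h2)

end ConstantOn

/-! ### Locally constant sheaves and coverings -/

section SimplyConnected

variable {k : Type u} [Ring k] {X : TopCat.{u}}

lemma IsSimplyConnectedSpace.isConnected {U : Opens X} (hU : IsSimplyConnectedSpace U) :
    IsConnected (U : Set X) :=
  isConnected_iff_connectedSpace.2 hU.1

open TopCat.Presheaf in
/-- The map from an open set to the étale space defined by a section. -/
noncomputable def sectionToEtaleSpace (F : Shv k X) {U : Opens X} (s : F.obj.obj (op U)) (y : U) :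
    EtaleSpace F.presheaf :=
  ⟨y.1, F.presheaf.germ U y.1 y.2 s⟩

open TopCat.Presheaf in
lemma continuous_sectionToEtaleSpace (F : Shv k X) {U : Opens X} (s : F.obj.obj (op U)) :
    Continuous (sectionToEtaleSpace F s) := by
  refine continuous_generateFrom_iff.2 ?_
  rintro _ ⟨V, t, rfl⟩
  rw [isOpen_iff_mem_nhds]
  rintro y ⟨hy, e⟩
  obtain ⟨W, hyW, i, j, h⟩ := F.presheaf.germ_eq y.1 y.2 hy s t e
  refine Filter.mem_of_superset ((W.isOpen.preimage continuous_subtype_val).mem_nhds hyW) ?_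
  intro z hz
  refine ⟨j.le hz, ?_⟩
  have h1 := F.presheaf.germ_res_apply i z.1 hz s
  have h2 := F.presheaf.germ_res_apply j z.1 hz t
  exact h1.symm.trans (congr(F.presheaf.germ W z.1 hz $h).trans h2)

open TopCat.Presheaf in
lemma sectionToEtaleSpace_eq (F : Shv k X) {U : Opens X} (s : F.obj.obj (op U))
    {e : EtaleSpace F.presheaf} {z : X} (hz : e.base = z) (ha : e.base ∈ U)
    (hg : e.germ = F.presheaf.germ U e.base ha s) :
    sectionToEtaleSpace F s ⟨z, hz ▸ ha⟩ = e := by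
  subst hz
  exact congrArg (EtaleSpace.mk e.base) hg.symm

open TopCat.Presheaf in
-- A continuous section of the étale space is locally given by sections of `F`; these have equal
-- germs on overlaps, hence glue.
lemma exists_section_of_continuous (F : Shv k X) {U : Opens X} (σ : U → EtaleSpace F.presheaf)
    (hσ : Continuous σ) (hb : ∀ y, (σ y).base = y.1) :
    ∃ s : F.obj.obj (op U), ∀ y, sectionToEtaleSpace F s y = σ y := by
  have loc (y : U) : ∃ (V : Opens X) (_ : V ≤ U) (s : F.obj.obj (op V)), y.1 ∈ V ∧
      ∀ z : U, ∀ hz : z.1 ∈ V, sectionToEtaleSpace F s ⟨z.1, hz⟩ = σ z := by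
    obtain ⟨V, hV, s, hs⟩ := EtaleSpace.exists_section_of_tendsto (hσ.tendsto y)
    obtain ⟨W, hWs, hWo, hyW⟩ := mem_nhds_iff.1 hs
    obtain ⟨W', hW'o, rfl⟩ := isOpen_induced_iff.1 hWo
    rw [hb] at hV
    let W'' : Opens X := ⟨W', hW'o⟩
    refine ⟨V ⊓ W'' ⊓ U, inf_le_right, sheafRes F (inf_le_left.trans inf_le_left) s,
      ⟨⟨hV, hyW⟩, y.2⟩, fun z hz => ?_⟩
    obtain ⟨ha, hg⟩ := hWs (show z ∈ Subtype.val ⁻¹' W' from hz.1.2)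
    have h1 := F.presheaf.germ_res_apply
      (homOfLE (inf_le_left.trans inf_le_left : V ⊓ W'' ⊓ U ≤ V)) z.1 hz s
    have h2 := sectionToEtaleSpace_eq F s (hb z) ha hg
    exact (congrArg (EtaleSpace.mk z.1) h1).trans h2
  choose V hVU s hyV hs using loc
  obtain ⟨t, ht⟩ := exists_sheafRes_eq_of_compatible F V hVU hyV s fun x y => by
    refine TopCat.Presheaf.section_ext F _ _ _ fun z hz => ?_
    have e := (hs x ⟨z, hVU _ hz.1⟩ hz.1).trans (hs y ⟨z, hVU _ hz.1⟩ hz.2).symm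
    have h1 := F.presheaf.germ_res_apply (homOfLE (inf_le_left : V x ⊓ V y ≤ V x)) z hz (s x)
    have h2 := F.presheaf.germ_res_apply (homOfLE (inf_le_right : V x ⊓ V y ≤ V y)) z hz (s y)
    simp only [sectionToEtaleSpace, EtaleSpace.mk.injEq, heq_eq_eq, true_and] at e
    exact h1.trans (e.trans h2.symm)
  refine ⟨t, fun y => ?_⟩
  rw [← hs y y (hyV y), ← ht y]
  exact congrArg _ (F.presheaf.germ_res_apply (homOfLE (hVU y)) y.1 (hyV y) t).symm

open TopCat.Presheaf in
/-- A locally constant sheaf is constant on simply connected open sets. -/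
lemma IsConstantOn.of_isSimplyConnectedSpace {F : Shv k X}
    (hF : ∀ x, ∃ V : Opens X, x ∈ V ∧ IsConstantOn F V) {U : Opens X}
    (hU : IsSimplyConnectedSpace U) : IsConstantOn F U := by
  have cov : IsCoveringMap (EtaleSpace.base (F := F.presheaf)) :=
    EtaleSpace.isCoveringMap_base fun x => by
      obtain ⟨V, hx, hV⟩ := hF x
      exact ⟨V, hx, fun y hy => germ_bijective hV y hy⟩
  let p := (U : Set X).restrictPreimage (EtaleSpace.base (F := F.presheaf))
  have hp : IsCoveringMap p := IsCoveringMapOn.isCoveringMap_restrictPreimage _ fun x _ => cov x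
  obtain ⟨I, _, _, h, hh⟩ := hU.2 _ p hp
  let σ (s : F.obj.obj (op U)) (y : U) : EtaleSpace.base (F := F.presheaf) ⁻¹' (U : Set X) :=
    ⟨sectionToEtaleSpace F s y, y.2⟩
  have : PreconnectedSpace U := hU.1.1
  -- In the trivialization over `U`, a section has a continuous coordinate in the discrete `I`,
  -- constant by connectedness; its value at one point therefore determines the section.
  have const (s : F.obj.obj (op U)) (y y' : U) : (h (σ s y)).2 = (h (σ s y')).2 := by
    have hc : Continuous fun y => (h (σ s y)).2 :=
      continuous_snd.comp (h.continuous.comp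
        ((continuous_sectionToEtaleSpace F s).subtype_mk _))
    exact (IsLocallyConstant.iff_continuous _).2 hc |>.apply_eq_of_preconnectedSpace y y'
  have σ_eq (s t : F.obj.obj (op U)) (y : U) (e : (h (σ s y)).2 = (h (σ t y)).2) :
      F.presheaf.germ U y.1 y.2 s = F.presheaf.germ U y.1 y.2 t := by
    have : σ s y = σ t y := h.injective (Prod.ext ((hh (σ s y)).trans (hh (σ t y)).symm) e)
    simpa [σ, sectionToEtaleSpace] using this
  refine ⟨fun {W} hW hne s t e => ?_, fun {W} hW s {x} hx => ?_⟩
  · obtain ⟨x, hx⟩ := hne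
    refine TopCat.Presheaf.section_ext F _ _ _ fun y hy => σ_eq s t ⟨y, hy⟩ ?_
    rw [const s _ ⟨x, hW hx⟩, const t _ ⟨x, hW hx⟩]
    congr 2
    refine Subtype.ext (congrArg (EtaleSpace.mk x) ?_)
    have h1 := F.presheaf.germ_res_apply (homOfLE hW) x hx s
    have h2 := F.presheaf.germ_res_apply (homOfLE hW) x hx t
    exact h1.symm.trans (congr(F.presheaf.germ W x hx $e).trans h2)
  -- The extension to `U` is the horizontal sheet `U × {i}` through the germ of `s` at `x`.
  · let i := (h ⟨sectionToEtaleSpace F s ⟨x, hx⟩, hW hx⟩).2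
    let τ (y : U) : EtaleSpace F.presheaf := (h.symm (y, i)).1
    have hτ : Continuous τ := continuous_subtype_val.comp
      (h.symm.continuous.comp (continuous_id.prodMk continuous_const))
    obtain ⟨m, hm⟩ := exists_section_of_continuous F τ hτ fun y => by
      have := hh (h.symm (y, i))
      rw [h.apply_symm_apply] at this
      exact congr_arg Subtype.val this.symm
    have e : sectionToEtaleSpace F m ⟨x, hW hx⟩ = sectionToEtaleSpace F s ⟨x, hx⟩ := by
      rw [hm]
      have : ((⟨x, hW hx⟩ : U), i) = h ⟨sectionToEtaleSpace F s ⟨x, hx⟩, hW hx⟩ :=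
        Prod.ext (hh ⟨sectionToEtaleSpace F s ⟨x, hx⟩, hW hx⟩).symm rfl
      simp only [τ]
      rw [this, h.symm_apply_apply]
    simp only [sectionToEtaleSpace, EtaleSpace.mk.injEq, heq_eq_eq, true_and] at e
    obtain ⟨V, hxV, i, j, hV⟩ := F.presheaf.germ_eq x (hW hx) hx m s e
    exact ⟨V, j.le, m, hxV, hV.symm⟩

end SimplyConnected

/-! ### Characterization of quasi-coherent sheaves -/

section Quasicoherent

variable {k : Type u} [Ring k] {X : TopCat.{u}}

lemma Opens.exists_eq_functor_obj {U V : Opens X} (h : V ≤ U) :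
    ∃ W : Opens (TopCat.of U), V = U.isOpenEmbedding.isOpenMap.functor.obj W := by
  refine ⟨(Opens.map U.inclusion').obj V, ?_⟩
  ext x
  constructor
  · intro hx
    exact ⟨⟨x, h hx⟩, hx, rfl⟩
  · rintro ⟨y, hy, rfl⟩
    exact hy

lemma Opens.le_of_functor_obj_le {U : Opens X} {V W : Opens (TopCat.of U)}
    (h : U.isOpenEmbedding.isOpenMap.functor.obj V ≤ U.isOpenEmbedding.isOpenMap.functor.obj W) :
    V ≤ W := by
  intro x hx
  obtain ⟨y, hy, e⟩ := h ⟨x, hx, rfl⟩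
  rwa [← Subtype.ext e]

lemma Opens.functor_obj_le {U : Opens X} (V : Opens (TopCat.of U)) :
    U.isOpenEmbedding.isOpenMap.functor.obj V ≤ U := by
  rintro _ ⟨y, hy, rfl⟩
  exact y.2

lemma isConnected_functor_obj_iff {U : Opens X} (V : Opens (TopCat.of U)) :
    IsConnected (U.isOpenEmbedding.isOpenMap.functor.obj V : Set X) ↔
      IsConnected (V : Set (TopCat.of U)) := by
  refine and_congr Set.image_nonempty ?_
  exact Topology.IsInducing.subtypeVal.isPreconnected_image

lemma isConstantOn_restrictSheaf_iff (F : Shv k X) (U : Opens X) (W : Opens (TopCat.of U)) :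
    IsConstantOn (restrictSheaf F U) W ↔
      IsConstantOn F (U.isOpenEmbedding.isOpenMap.functor.obj W) := by
  constructor
  · intro H
    refine ⟨fun {V} h hne => ?_, fun {V} h s {x} hx => ?_⟩
    · obtain ⟨V, rfl⟩ := Opens.exists_eq_functor_obj (h.trans (Opens.functor_obj_le W))
      exact H.injective (Opens.le_of_functor_obj_le h) (Set.image_nonempty.1 hne)
    · obtain ⟨V, rfl⟩ := Opens.exists_eq_functor_obj (h.trans (Opens.functor_obj_le W))
      obtain ⟨y, hy, rfl⟩ := hx
      obtain ⟨V', h', m, hyV, e⟩ := H.exists_extension (Opens.le_of_functor_obj_le h) s hy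
      exact ⟨U.isOpenEmbedding.isOpenMap.functor.obj V', Set.image_mono h', m, ⟨y, hyV, rfl⟩, e⟩
  · intro H
    refine ⟨fun {V} h hne => ?_, fun {V} h s {x} hx => ?_⟩
    · exact H.injective (Set.image_mono h : U.isOpenEmbedding.isOpenMap.functor.obj V ≤ _)
        (hne.image _)
    · obtain ⟨V', h', m, hyV, e⟩ := H.exists_extension
        (Set.image_mono h : U.isOpenEmbedding.isOpenMap.functor.obj V ≤ _) s (x := x.1)
        ⟨x, hx, rfl⟩
      obtain ⟨V', rfl⟩ := Opens.exists_eq_functor_obj (h'.trans (Opens.functor_obj_le V))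
      obtain ⟨y, hy, e'⟩ := hyV
      exact ⟨V', Opens.le_of_functor_obj_le h', m, by rwa [← Subtype.ext e'], e⟩

variable (k X) in
/-- The constant sheaf functor. -/
noncomputable def constShv : ModuleCat.{u} k ⥤ Shv k X :=
  constantSheaf (Opens.grothendieckTopology X) (ModuleCat.{u} k)

variable (k X) in
/-- The constant sheaf functor is left adjoint to the global sections functor. -/
noncomputable def constShvAdj : constShv k X ⊣ globalSections k X :=
  constantSheafAdj _ _ (isTerminalTop : IsTerminal (⊤ : Opens X))

instance : (constShv k X).IsLeftAdjoint := (constShvAdj k X).isLeftAdjoint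

/-- Constant sheaves associated with free modules are free. -/
noncomputable def constShvObjFreeIso (I : Type u) :
    (constShv k X).obj (∐ fun _ : I => ModuleCat.of k k) ≅ freeSheaf k X I :=
  PreservesCoproduct.iso (constShv k X) fun _ : I => ModuleCat.of k k

lemma isConstantOn_freeSheaf (I : Type u) {U : Opens X} (hU : IsConnected (U : Set X)) :
    IsConstantOn (freeSheaf k X I) U := by
  exact (isConstantOn_constantSheaf _ hU).of_iso (constShvObjFreeIso I) hU

/-- Quasi-coherent sheaves are constant on simply connected open sets. -/
lemma isConstantOn_of_isQuasicoherentSheaf (hX : IsLocallySimplyConnectedSpace X) {F : Shv k X}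
    (hF : isQuasicoherentSheaf k X F) {U : Opens X} (hU : IsSimplyConnectedSpace U) :
    IsConstantOn F U := by
  refine .of_isSimplyConnectedSpace (fun x => ?_) hU
  obtain ⟨U, hxU, I, J, f, g, zero, ex, _⟩ := hF x
  obtain ⟨V, hxV, hVU, hV⟩ := hX x U hxU
  obtain ⟨V, rfl⟩ := Opens.exists_eq_functor_obj hVU
  have hVc := (isConnected_functor_obj_iff V).1 hV.isConnected
  exact ⟨_, hxV, (isConstantOn_restrictSheaf_iff F U V).1 (.of_exact f g zero ex hVc
    (isConstantOn_freeSheaf I hVc) (isConstantOn_freeSheaf J hVc))⟩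

lemma ModuleCat.exists_epi_free (M : ModuleCat.{u} k) :
    ∃ (J : Type u) (g : (∐ fun _ : J => ModuleCat.of k k) ⟶ M), Epi g := by
  refine ⟨M, Sigma.desc fun m => ModuleCat.ofHom (LinearMap.toSpanSingleton k M m), ?_⟩
  rw [ModuleCat.epi_iff_surjective]
  intro m
  refine ⟨(Sigma.ι (fun _ : M => ModuleCat.of k k) m).hom (1 : k), ?_⟩
  rw [← ModuleCat.comp_apply, Sigma.ι_desc]
  simp

lemma ModuleCat.exists_presentation (M : ModuleCat.{u} k) :
    ∃ (I J : Type u) (f : (∐ fun _ : I => ModuleCat.of k k) ⟶ ∐ fun _ : J => ModuleCat.of k k)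
      (g : (∐ fun _ : J => ModuleCat.of k k) ⟶ M) (zero : f ≫ g = 0),
      (ShortComplex.mk f g zero).Exact ∧ Epi g := by
  obtain ⟨J, g, hg⟩ := M.exists_epi_free
  obtain ⟨I, f, hf⟩ := (kernel g).exists_epi_free
  refine ⟨I, J, f ≫ kernel.ι g, g, by simp, ?_, hg⟩
  rw [ShortComplex.exact_iff_epi_kernel_lift]
  have : kernel.lift g (f ≫ kernel.ι g) (by simp) = f := by
    rw [← cancel_mono (kernel.ι g), kernel.lift_ι]
  simpa only [this] using hf

/-- The constant sheaf associated with a module has a presentation by free sheaves. -/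
lemma exists_presentation_constShv (M : ModuleCat.{u} k) :
    ∃ (I J : Type u) (f : freeSheaf k X I ⟶ freeSheaf k X J)
      (g : freeSheaf k X J ⟶ (constShv k X).obj M) (zero : f ≫ g = 0),
      (ShortComplex.mk f g zero).Exact ∧ Epi g := by
  obtain ⟨I, J, f, g, zero, ex, _⟩ := M.exists_presentation
  have : PreservesColimitsOfSize.{0, 0} (constShv k X) :=
    (constShvAdj k X).leftAdjoint_preservesColimits
  refine ⟨I, J, (constShvObjFreeIso I).inv ≫ (constShv k X).map f ≫ (constShvObjFreeIso J).hom,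
    (constShvObjFreeIso J).inv ≫ (constShv k X).map g, ?_, ?_, ?_⟩
  · rw [Category.assoc, Category.assoc, Iso.hom_inv_id_assoc, ← Functor.map_comp, zero,
      Functor.map_zero, comp_zero]
  · refine (ShortComplex.exact_iff_of_iso ?_).1
      (ex.map_of_epi_of_preservesCokernel (constShv k X) inferInstance inferInstance)
    exact ShortComplex.isoMk (constShvObjFreeIso I) (constShvObjFreeIso J) (Iso.refl _)
      (Iso.hom_inv_id_assoc _ _) ((Iso.hom_inv_id_assoc _ _).trans (Category.comp_id _).symm)
  · have : Epi ((constShv k X).map g) := inferInstance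
    exact epi_comp _ _

/-- Restriction of global sections maps the constant presheaf to `F`; this map is locally bijective,
so sheafification inverts it. -/
lemma nonempty_constShv_iso {F : Shv k X} (hF : IsConstantOn F ⊤) :
    Nonempty ((constShv k X).obj (F.obj.obj (op ⊤)) ≅ F) := by
  let J := Opens.grothendieckTopology X
  let P : (Opens X)ᵒᵖ ⥤ ModuleCat.{u} k := (Functor.const _).obj (F.obj.obj (op ⊤))
  let p : P ⟶ F.obj :=
    { app V := F.obj.map (homOfLE le_top).op
      naturality V W i := by
        dsimp [P]
        rw [Category.id_comp, ← F.obj.map_comp]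
        rfl }
  have h1 : Presheaf.IsLocallyInjective J p :=
    { equalizerSieve_mem := fun {V} s t e x hx => by
        have : s = t := hF.injective (le_top : V.unop ≤ ⊤) ⟨x, hx⟩ e
        exact ⟨V.unop, 𝟙 _, congrArg _ this, hx⟩ }
  have h2 : Presheaf.IsLocallySurjective J p :=
    { imageSieve_mem := fun {V} s x hx => by
        obtain ⟨W, h, m, hxW, e⟩ := hF.exists_extension (le_top : V ≤ ⊤) s hx
        exact ⟨W, homOfLE h, ⟨m, e.symm⟩, hxW⟩ }
  have hp : J.W p := (J.W_iff_isLocallyBijective p).2 ⟨h1, h2⟩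
  have : IsIso ((presheafToSheaf J _).map p) := (J.W_iff p).1 hp
  let e : (presheafToSheaf J _).obj P ≅ F := 
    @asIso _ _ _ _ _ this ≪≫ (sheafificationIso F).symm
  exact ⟨e⟩

lemma isQuasicoherentSheaf_of_isConstantOn {F : Shv k X}
    (hF : ∀ x, ∃ U : Opens X, x ∈ U ∧ IsConstantOn F U) :
    isQuasicoherentSheaf k X F := by
  intro x
  obtain ⟨U, hxU, hU⟩ := hF x
  have : IsConstantOn (restrictSheaf F U) ⊤ := by
    rw [isConstantOn_restrictSheaf_iff]
    convert hU
    refine le_antisymm (Opens.functor_obj_le _) fun x hx => ⟨⟨x, hx⟩, trivial, rfl⟩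
  obtain ⟨e⟩ := nonempty_constShv_iso this
  obtain ⟨I, J, f, g, zero, ex, _⟩ := exists_presentation_constShv (X := TopCat.of U)
    ((restrictSheaf F U).obj.obj (op ⊤))
  refine ⟨U, hxU, I, J, f, g ≫ e.hom, ?_, ?_, epi_comp _ _⟩
  · rw [← Category.assoc, zero, zero_comp]
  refine (ShortComplex.exact_iff_of_iso ?_).1 ex
  exact ShortComplex.isoMk (Iso.refl _) (Iso.refl _) e (by simp) (by simp)

/-- On a locally simply connected space, quasi-coherent sheaves are the sheaves whose restriction
maps between simply connected open sets are bijective. -/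
lemma isQuasicoherentSheaf_iff (hX : IsLocallySimplyConnectedSpace X) (F : Shv k X) :
    isQuasicoherentSheaf k X F ↔ ∀ (U V : Opens X) (h : V ≤ U), IsSimplyConnectedSpace U →
      IsSimplyConnectedSpace V → Function.Bijective (sheafRes F h) := by
  refine ⟨fun hF U V h hU hV =>
    (isConstantOn_of_isQuasicoherentSheaf hX hF hU).bijective h hV.isConnected,
    fun H => isQuasicoherentSheaf_of_isConstantOn fun x => ?_⟩
  obtain ⟨U, hxU, -, hU⟩ := hX x ⊤ trivial
  refine ⟨U, hxU, .of_family F hU.isConnected id (fun {W} h hne m m' e => ?_)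
    fun {W} h s {x} hx => ?_⟩
  · obtain ⟨x, hx⟩ := hne
    obtain ⟨V, hxV, hVW, hV⟩ := hX x W hx
    refine (H U V (hVW.trans h) hU hV).1 ?_
    have := congr(sheafRes F hVW $e)
    rwa [sheafRes_sheafRes, sheafRes_sheafRes] at this
  · obtain ⟨V, hxV, hVW, hV⟩ := hX x W hx
    obtain ⟨m, hm⟩ := (H U V (hVW.trans h) hU hV).2 (sheafRes F hVW s)
    exact ⟨V, hVW, m, hxV, hm.symm⟩

end Quasicoherent

/-! ### The quasicoherator -/

section Adjunction

/-- Inside `E`, the categories `A` and `D` have the same essential image, hence are equivalent, and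
the right adjoint of `Φ` gives one of `i ⋙ R`. As `R` is fully faithful, precomposing that adjoint
with `R` gives a right adjoint of `i`. -/
lemma CategoryTheory.Functor.isLeftAdjoint_of_comp_fullyFaithful {A B D E : Type*} [Category* A]
    [Category* B] [Category* D] [Category* E] (i : A ⥤ B) (R : B ⥤ E) (Φ : D ⥤ E)
    [i.Full] [i.Faithful] [R.Full] [R.Faithful] [Φ.Full] [Φ.Faithful] [Φ.IsLeftAdjoint]
    (h₁ : ∀ a, Φ.essImage (R.obj (i.obj a))) (h₂ : ∀ d, (i ⋙ R).essImage (Φ.obj d)) :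
    i.IsLeftAdjoint := by
  let Ψ : A ⥤ D := Functor.essImage.liftFunctor (i ⋙ R) Φ h₁
  let e : Ψ ⋙ Φ ≅ i ⋙ R := Functor.essImage.liftFunctorCompIso (i ⋙ R) Φ h₁
  have : (Ψ ⋙ Φ).Full := .of_iso e.symm
  have : (Ψ ⋙ Φ).Faithful := .of_iso e.symm
  have : Ψ.Full := .of_comp_faithful Ψ Φ
  have : Ψ.Faithful := .of_comp Ψ Φ
  have : Ψ.EssSurj := ⟨fun d => by
    obtain ⟨a, ⟨f⟩⟩ := h₂ d
    exact ⟨a, ⟨Φ.preimageIso (e.app a ≪≫ f)⟩⟩⟩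
  have : Ψ.IsEquivalence := {}
  have : (i ⋙ R).IsLeftAdjoint := Functor.isLeftAdjoint_of_iso e
  exact ((Adjunction.ofIsLeftAdjoint (i ⋙ R)).restrictFullyFaithful
    (Functor.FullyFaithful.id A) (.ofFullyFaithful R) (L := i)
    (R := R ⋙ (i ⋙ R).rightAdjoint) (Functor.leftUnitor _) (Functor.rightUnitor _).symm).isLeftAdjoint

variable {k : Type u} [Ring k] {X : TopCat.{u}}

variable (X) in
/-- The category of simply connected open subsets. -/
abbrev SimplyConnectedOpens : Type u :=
  ObjectProperty.FullSubcategory fun U : Opens X => IsSimplyConnectedSpace U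

variable (X) in
/-- The inclusion of simply connected open subsets. -/
abbrev SimplyConnectedOpens.ι : SimplyConnectedOpens X ⥤ Opens X := ObjectProperty.ι _

lemma SimplyConnectedOpens.isCoverDense (hX : IsLocallySimplyConnectedSpace X) :
    (SimplyConnectedOpens.ι X).IsCoverDense (Opens.grothendieckTopology X) := by
  rw [TopCat.Opens.coverDense_iff_isBasis, Opens.isBasis_iff_nbhd]
  intro U x hx
  obtain ⟨V, hxV, hVU, hV⟩ := hX x U hx
  exact ⟨V, ⟨⟨V, hV⟩, rfl⟩, hxV, hVU⟩

/-- On simply connected open subsets, a presheaf whose restriction maps are invertible is a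
sheaf. -/
lemma SimplyConnectedOpens.isSheaf (hX : IsLocallySimplyConnectedSpace X)
    (P : (SimplyConnectedOpens X)ᵒᵖ ⥤ Type u)
    (hP : ∀ ⦃U V : SimplyConnectedOpens X⦄ (f : V ⟶ U), Function.Bijective (P.map f.op)) :
    have := SimplyConnectedOpens.isCoverDense hX
    Presieve.IsSheaf ((SimplyConnectedOpens.ι X).inducedTopology
      (Opens.grothendieckTopology X)) P := by
  intro _ U S hS s hs
  replace hS := (Functor.mem_inducedTopology_iff_of_isCoverDense _ _ _).1 hS
  have cov (x : U.obj) : ∃ (V : SimplyConnectedOpens X) (f : V ⟶ U), S f ∧ x.1 ∈ V.obj := by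
    obtain ⟨V, i, ⟨W, f, j, hf, -⟩, hxV⟩ := hS x.1 x.2
    exact ⟨W, f, hf, j.le hxV⟩
  choose V f hf hx using cov
  choose t ht using fun x => (hP (f x)).2 (s (f x) (hf x))
  -- Compatibility on one simply connected open subset of the overlap is enough, since restriction
  -- to it is injective.
  have key {W : SimplyConnectedOpens X} (g : W ⟶ U) (hg : S g) (y : W.obj) (x : U.obj)
      (hy : y.1 ∈ (V x).obj) : P.map g.op (t x) = s g hg := by
    obtain ⟨W', hyW', hW', hsc⟩ := hX y (W.obj ⊓ (V x).obj) ⟨y.2, hy⟩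
    let W'' : SimplyConnectedOpens X := ⟨W', hsc⟩
    let i : W'' ⟶ W := ⟨homOfLE (hW'.trans inf_le_left)⟩
    let j : W'' ⟶ V x := ⟨homOfLE (hW'.trans inf_le_right)⟩
    refine (hP i).1 ((?_ : _ = P.map j.op (s (f x) (hf x))).trans (hs j i (hf x) hg rfl))
    rw [← ht, ← Functor.map_comp_apply, ← Functor.map_comp_apply]
    rfl
  obtain ⟨x₀, hx₀⟩ := U.property.isConnected.nonempty
  have : PreconnectedSpace U.obj := U.property.1.1
  -- Each local section extends uniquely to an element `t x` of `P(U)`; by `key` it is locally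
  -- constant in `x`, so all of these agree on the connected `U`.
  have hc : IsLocallyConstant t := by
    rw [IsLocallyConstant.iff_exists_open]
    refine fun x => ⟨Subtype.val ⁻¹' ((V x).obj : Set X),
      (V x).obj.isOpen.preimage continuous_subtype_val, hx x, fun y hy => (hP (f y)).1 ?_⟩
    rw [ht, key (f y) (hf y) ⟨y.1, hx y⟩ x hy]
  refine ⟨t ⟨x₀, hx₀⟩, fun W g hg => ?_, fun t' ht' => (hP (f ⟨x₀, hx₀⟩)).1 ?_⟩
  · obtain ⟨y, hy⟩ := W.property.isConnected.nonempty
    rw [hc.apply_eq_of_preconnectedSpace ⟨x₀, hx₀⟩ ⟨y, g.hom.le hy⟩]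
    exact key g hg ⟨y, hy⟩ _ (hx _)
  · rw [ht, ht' _ (hf _)]

variable (k X) in
/-- The restriction of sheaves to the simply connected open subsets. -/
noncomputable def restrictSimplyConnected :
    Shv k X ⥤ (SimplyConnectedOpens X)ᵒᵖ ⥤ ModuleCat.{u} k :=
  sheafToPresheaf (Opens.grothendieckTopology X) (ModuleCat.{u} k) ⋙
    (Functor.whiskeringLeft _ _ _).obj (SimplyConnectedOpens.ι X).op

section

variable (hX : IsLocallySimplyConnectedSpace X)
include hX

/-- The simply connected open sets form a basis, so sheaves on `X` are the same as sheaves on this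
dense subsite, which sit fully in its presheaves. -/
lemma full_restrictSimplyConnected : (restrictSimplyConnected k X).Full := by
  have := SimplyConnectedOpens.isCoverDense hX
  let J := (SimplyConnectedOpens.ι X).inducedTopology (Opens.grothendieckTopology X)
  exact inferInstanceAs ((SimplyConnectedOpens.ι X).sheafPushforwardContinuous (ModuleCat.{u} k) J
    (Opens.grothendieckTopology X) ⋙ sheafToPresheaf J _).Full

lemma faithful_restrictSimplyConnected : (restrictSimplyConnected k X).Faithful := by
  have := SimplyConnectedOpens.isCoverDense hX
  let J := (SimplyConnectedOpens.ι X).inducedTopology (Opens.grothendieckTopology X)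
  exact inferInstanceAs ((SimplyConnectedOpens.ι X).sheafPushforwardContinuous (ModuleCat.{u} k) J
    (Opens.grothendieckTopology X) ⋙ sheafToPresheaf J _).Faithful

lemma exists_restrictSimplyConnected_iso (P : (SimplyConnectedOpens X)ᵒᵖ ⥤ ModuleCat.{u} k)
    (hP : ∀ ⦃U V : (SimplyConnectedOpens X)ᵒᵖ⦄ (f : U ⟶ V), IsIso (P.map f)) :
    ∃ F : Shv k X, isQuasicoherentSheaf k X F ∧
      Nonempty ((restrictSimplyConnected k X).obj F ≅ P) := by
  have := SimplyConnectedOpens.isCoverDense hX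
  let J := (SimplyConnectedOpens.ι X).inducedTopology (Opens.grothendieckTopology X)
  have hP' : Presheaf.IsSheaf J P := by
    rw [Presheaf.isSheaf_iff_isSheaf_forget J P (forget _), isSheaf_iff_isSheaf_of_type]
    refine SimplyConnectedOpens.isSheaf hX _ fun U V f => ?_
    have := hP f.op
    exact (isIso_iff_bijective ((P ⋙ forget _).map f.op)).1 (inferInstanceAs
      (IsIso ((forget (ModuleCat.{u} k)).map (P.map f.op))))
  let Φ := (SimplyConnectedOpens.ι X).sheafPushforwardContinuous (ModuleCat.{u} k) J
    (Opens.grothendieckTopology X)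
  obtain ⟨F, ⟨e⟩⟩ : Φ.essImage ⟨P, hP'⟩ := Functor.EssSurj.mem_essImage (F := Φ) _
  let e' : (restrictSimplyConnected k X).obj F ≅ P := (sheafToPresheaf J _).mapIso e
  refine ⟨F, (isQuasicoherentSheaf_iff hX _).2 fun U V h hU hV => ?_, ⟨e'⟩⟩
  let U' : SimplyConnectedOpens X := ⟨U, hU⟩
  let V' : SimplyConnectedOpens X := ⟨V, hV⟩
  let f : V' ⟶ U' := ⟨homOfLE h⟩
  have := hP f.op
  have hf : IsIso (((restrictSimplyConnected k X).obj F).map f.op) :=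
    (NatIso.isIso_map_iff e' f.op).2 this
  exact ConcreteCategory.bijective_of_isIso (((restrictSimplyConnected k X).obj F).map f.op)

/-- The inclusion of quasi-coherent sheaves has a right adjoint. -/
lemma isLeftAdjoint_qcohInclusion : (qcohInclusion k X).IsLeftAdjoint := by
  -- Inverting all arrows makes functors on the localization the presheaves with bijective
  -- restriction maps. Precomposition with `W.Q` has right Kan extension as right adjoint.
  let W : MorphismProperty (SimplyConnectedOpens X)ᵒᵖ := ⊤
  let Φ : (W.Localization ⥤ ModuleCat.{u} k) ⥤ (SimplyConnectedOpens X)ᵒᵖ ⥤ ModuleCat.{u} k :=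
    (Functor.whiskeringLeft _ _ _).obj W.Q
  have := full_restrictSimplyConnected (k := k) hX
  have := faithful_restrictSimplyConnected (k := k) hX
  have : Φ.Full := Localization.full_whiskeringLeft W.Q W _
  have : Φ.Faithful := Localization.faithful_whiskeringLeft W.Q W _
  have : Φ.IsLeftAdjoint := (W.Q.ranAdjunction (ModuleCat.{u} k)).isLeftAdjoint
  refine (qcohInclusion k X).isLeftAdjoint_of_comp_fullyFaithful (restrictSimplyConnected k X) Φ
    (fun F => ?_) fun P => ?_
  · have hF : W.IsInvertedBy ((restrictSimplyConnected k X).obj F.obj) := by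
      intro U V f _
      rw [ConcreteCategory.isIso_iff_bijective]
      exact (isQuasicoherentSheaf_iff hX _).1 F.property _ _ f.unop.hom.le U.unop.property
        V.unop.property
    exact ⟨Localization.lift _ hF W.Q, ⟨Localization.fac _ hF W.Q⟩⟩
  · obtain ⟨F, hF, ⟨e⟩⟩ := exists_restrictSimplyConnected_iso hX (Φ.obj P) fun U V f => by
      have : IsIso (W.Q.map f) := Localization.inverts W.Q W f trivial
      exact inferInstanceAs (IsIso (P.map (W.Q.map f)))
    exact ⟨⟨F, hF⟩, ⟨e⟩⟩

end

end Adjunction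

/-! ### Abelian structure and injectives of quasi-coherent sheaves -/

section AbelianSubcategory

variable {k : Type u} [Ring k] {X : TopCat.{u}}

variable (k) in
/-- The restriction maps, as a natural transformation. -/
noncomputable def sheafEvalRes {U V : Opens X} (h : V ≤ U) : sheafEval k U ⟶ sheafEval k V :=
  Functor.whiskerLeft _ ((evaluation (Opens X)ᵒᵖ (ModuleCat.{u} k)).map (homOfLE h).op)

lemma isIso_sheafEvalRes_app_iff (F : Shv k X) {U V : Opens X} (h : V ≤ U) :
    IsIso ((sheafEvalRes k h).app F) ↔ Function.Bijective (sheafRes F h) :=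
  ConcreteCategory.isIso_iff_bijective _

variable (hX : IsLocallySimplyConnectedSpace X)
include hX

/-- Sections over an open set preserve limits, so the restriction map of a limit is a limit of
isomorphisms. -/
lemma isClosedUnderLimitsOfShape_isQuasicoherentSheaf (J : Type*) [Category* J]
    [HasLimitsOfShape J (ModuleCat.{u} k)] :
    (isQuasicoherentSheaf k X).IsClosedUnderLimitsOfShape J where
  limitsOfShape_le F := by
    rintro ⟨p⟩
    refine (isQuasicoherentSheaf_iff hX F).2 fun U V h hU hV => ?_
    rw [← isIso_sheafEvalRes_app_iff]
    let τ := Functor.whiskerLeft p.diag (sheafEvalRes k h)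
    have (j : J) : IsIso (τ.app j) := (isIso_sheafEvalRes_app_iff _ _).2
      ((isQuasicoherentSheaf_iff hX _).1 (p.prop_diag_obj j) U V h hU hV)
    have : IsIso τ := NatIso.isIso_of_isIso_app τ
    let h₁ := isLimitOfPreserves (sheafEval k U) p.isLimit
    let h₂ := isLimitOfPreserves (sheafEval k V) p.isLimit
    have e : (sheafEvalRes k h).app F = (h₁.conePointsIsoOfNatIso h₂ (asIso τ)).hom :=
      h₂.hom_ext fun j => by
        rw [IsLimit.conePointsIsoOfNatIso_hom_comp]
        exact ((sheafEvalRes k h).naturality (p.π.app j)).symm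
    rw [e]
    infer_instance

open scoped ZeroObject in
lemma isAbelianSubcategory_isQuasicoherentSheaf :
    IsAbelianSubcategory (isQuasicoherentSheaf k X) where
  exists_zero := by
    refine ⟨0, isZero_zero _, (isQuasicoherentSheaf_iff hX _).2 fun U V h hU hV => ?_⟩
    have (U : Opens X) : Subsingleton ((0 : Shv k X).obj.obj (op U)) :=
      ModuleCat.subsingleton_of_isZero ((sheafEval k U).map_isZero (isZero_zero _))
    exact ⟨Function.injective_of_subsingleton _, fun x => ⟨0, Subsingleton.elim _ _⟩⟩
  isClosedUnderLimitsOfShape J _ := isClosedUnderLimitsOfShape_isQuasicoherentSheaf hX _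
  kernels_le := by
    rintro _ ⟨f, c, hc, hf₁, hf₂⟩
    have := isClosedUnderLimitsOfShape_isQuasicoherentSheaf (k := k) hX WalkingParallelPair
    exact ObjectProperty.prop_of_isLimit _ hc (by rintro (_ | _) <;> assumption)
  cokernels_le := by
    rintro _ ⟨f, c, hc, hf₁, hf₂⟩
    -- Sections are not right exact, so here local constancy is used instead of bijectivity of
    -- restriction maps.
    refine isQuasicoherentSheaf_of_isConstantOn fun x => ?_
    obtain ⟨U, hxU, -, hU⟩ := hX x ⊤ trivial
    have : Epi c.π := Cofork.IsColimit.epi hc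
    have ex : (ShortComplex.mk f c.π c.condition).Exact :=
      ShortComplex.exact_of_g_is_cokernel _
        (IsColimit.ofIsoColimit hc (Cofork.ext (Iso.refl _) (Category.comp_id _)))
    exact ⟨U, hxU, .of_exact f c.π c.condition ex hU.isConnected
      (isConstantOn_of_isQuasicoherentSheaf hX hf₁ hU)
      (isConstantOn_of_isQuasicoherentSheaf hX hf₂ hU)⟩

omit hX

lemma preservesMonomorphisms_qcohInclusion [IsAbelianSubcategory (isQuasicoherentSheaf k X)] :
    (qcohInclusion k X).PreservesMonomorphisms := by
  have := (isQuasicoherentSheaf k X).preservesKernels_ι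
  have := (qcohInclusion k X).preservesFiniteLimits_of_preservesKernels
  infer_instance

/-- A quasi-coherent sheaf embeds, as a sheaf, into an injective `I`; the adjoint map embeds it into
Qc(`I`), which is injective because the inclusion preserves monomorphisms. -/
lemma enoughInjectives_qcoh [IsAbelianSubcategory (isQuasicoherentSheaf k X)]
    [(qcohInclusion k X).IsLeftAdjoint] : EnoughInjectives (Qcoh k X) := by
  have := preservesMonomorphisms_qcohInclusion (k := k) (X := X)
  exact EnoughInjectives.of_adjunction (quasicoheratorAdj k X)

end AbelianSubcategory

/-! ### Derived functor of a composite -/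

namespace CategoryTheory.Functor

variable {C D E : Type*} [Category* C] [Category* D] [Category* E] [Abelian C] [Abelian D]
  [Abelian E] [HasDerivedCategory C] [HasDerivedCategory D] [HasDerivedCategory E]
  [EnoughInjectives C] [EnoughInjectives D]
  {F : C ⥤ D} {G : D ⥤ E} {H : C ⥤ E} [F.Additive] [G.Additive] [H.Additive]

/-- The natural transformation inducing the comparison between the derived functor of a composite
functor and the composite of the derived functors. -/
noncomputable def rightDerivedFunctorPlusCompUnit (e : F ⋙ G ≅ H) :
    H.mapHomotopyCategoryPlus ⋙ DerivedCategory.Plus.Qh ⟶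
      DerivedCategory.Plus.Qh ⋙ F.rightDerivedFunctorPlus ⋙ G.rightDerivedFunctorPlus :=
  whiskerRight (mapHomotopyCategoryPlusCompIso e).inv DerivedCategory.Plus.Qh ≫
    (associator _ _ _).hom ≫
    whiskerLeft F.mapHomotopyCategoryPlus G.rightDerivedFunctorPlusUnit ≫
    (associator _ _ _).inv ≫
    whiskerRight F.rightDerivedFunctorPlusUnit G.rightDerivedFunctorPlus ≫
    (associator _ _ _).hom

lemma rightDerivedFunctorPlusCompUnit_app (e : F ⋙ G ≅ H) (K : HomotopyCategory.Plus C) :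
    (rightDerivedFunctorPlusCompUnit e).app K =
      DerivedCategory.Plus.Qh.map ((mapHomotopyCategoryPlusCompIso e).inv.app K) ≫
        G.rightDerivedFunctorPlusUnit.app (F.mapHomotopyCategoryPlus.obj K) ≫
        G.rightDerivedFunctorPlus.map (F.rightDerivedFunctorPlusUnit.app K) := by
  simp [rightDerivedFunctorPlusCompUnit]

/-- The comparison between the derived functor of a composite functor and the composite of the
derived functors. -/
noncomputable def rightDerivedFunctorPlusCompHom (e : F ⋙ G ≅ H) :
    H.rightDerivedFunctorPlus ⟶ F.rightDerivedFunctorPlus ⋙ G.rightDerivedFunctorPlus :=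
  H.rightDerivedFunctorPlus.rightDerivedDesc H.rightDerivedFunctorPlusUnit
    (HomotopyCategory.Plus.quasiIso C) _ (rightDerivedFunctorPlusCompUnit e)

lemma rightDerivedFunctorPlusCompHom_fac (e : F ⋙ G ≅ H) (K : HomotopyCategory.Plus C) :
    H.rightDerivedFunctorPlusUnit.app K ≫
        (rightDerivedFunctorPlusCompHom e).app (DerivedCategory.Plus.Qh.obj K) =
      DerivedCategory.Plus.Qh.map ((mapHomotopyCategoryPlusCompIso e).inv.app K) ≫
        G.rightDerivedFunctorPlusUnit.app (F.mapHomotopyCategoryPlus.obj K) ≫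
        G.rightDerivedFunctorPlus.map (F.rightDerivedFunctorPlusUnit.app K) :=
  (rightDerived_fac_app _ _ _ _ _ K).trans (rightDerivedFunctorPlusCompUnit_app e K)

/-- If `F` preserves injective objects, then `R(F ⋙ G)` is the composite of `RF` and `RG`. -/
lemma isIso_rightDerivedFunctorPlusCompHom (e : F ⋙ G ≅ H)
    (hF : ∀ I : C, Injective I → Injective (F.obj I)) :
    IsIso (rightDerivedFunctorPlusCompHom e) := by
  have (K : DerivedCategory.Plus C) : IsIso ((rightDerivedFunctorPlusCompHom e).app K) := by
    obtain ⟨K, ⟨f⟩⟩ := EssSurj.mem_essImage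
      (F := (InjectiveObject.ι C).mapHomotopyCategoryPlus ⋙ DerivedCategory.Plus.Qh) K
    rw [← NatTrans.isIso_app_iff_of_iso _ f]
    let I := (InjectiveObject.ι C).mapHomotopyCategoryPlus.obj K
    -- On a complex of injectives the units of `H` and `F` are invertible; injectivity of the terms
    -- of `F(I)` makes that of `G` invertible too.
    have (n : ℤ) : Injective ((F.mapHomotopyCategoryPlus.obj I).obj.as.X n) :=
      hF (I.obj.as.X n) inferInstance
    change IsIso ((rightDerivedFunctorPlusCompHom e).app (DerivedCategory.Plus.Qh.obj I))
    have h := rightDerivedFunctorPlusCompHom_fac e I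
    rw [← cancel_epi (CategoryTheory.inv (H.rightDerivedFunctorPlusUnit.app I)), IsIso.inv_hom_id_assoc] at h
    rw [h]
    infer_instance
  exact NatIso.isIso_of_isIso_app _

end CategoryTheory.Functor

/-! ### Global sections of the quasicoherator -/

section CounitGlobalSections

variable {k : Type u} [Ring k] {X : TopCat.{u}}

lemma ModuleCat.isIso_of_bijective_comp {M N : ModuleCat.{u} k} (f : M ⟶ N)
    (hf : Function.Bijective fun m : ModuleCat.of k k ⟶ M => m ≫ f) : IsIso f := by
  rw [ConcreteCategory.isIso_iff_bijective]
  have key (P : ModuleCat.{u} k) (p : P) :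
      ((ModuleCat.ofHom (LinearMap.toSpanSingleton k P p)).hom (1 : k)) = p := by simp
  constructor
  · intro m m' h
    have : ModuleCat.ofHom (LinearMap.toSpanSingleton k M m) =
        ModuleCat.ofHom (LinearMap.toSpanSingleton k M m') := hf.1 (by
      ext
      simpa using h)
    simpa using congr(($this).hom (1 : k))
  · intro n
    obtain ⟨m, hm⟩ := hf.2 (ModuleCat.ofHom (LinearMap.toSpanSingleton k N n))
    refine ⟨m.hom (1 : k), ?_⟩
    have := congr(($hm).hom (1 : k))
    simpa using this

lemma isQuasicoherentSheaf_constSheaf (hX : IsLocallySimplyConnectedSpace X) :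
    isQuasicoherentSheaf k X (constSheaf k X) := by
  refine isQuasicoherentSheaf_of_isConstantOn fun x => ?_
  obtain ⟨U, hxU, -, hU⟩ := hX x ⊤ trivial
  exact ⟨U, hxU, isConstantOn_constantSheaf _ hU.isConnected⟩

/-- Global sections are Hom(k_X, -), and since k_X is quasi-coherent the adjunction identifies the
maps from it to Qc(`F`) with those to `F`. -/
lemma isIso_globalSections_map_counit (hX : IsLocallySimplyConnectedSpace X)
    [(qcohInclusion k X).IsLeftAdjoint] (F : Shv k X) :
    IsIso ((globalSections k X).map ((quasicoheratorAdj k X).counit.app F)) := by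
  refine ModuleCat.isIso_of_bijective_comp _ ?_
  let Q : Qcoh k X := ⟨(constShv k X).obj (ModuleCat.of k k), isQuasicoherentSheaf_constSheaf hX⟩
  let e₁ := (constShvAdj k X).homEquiv (ModuleCat.of k k)
    ((qcohInclusion k X).obj ((quasicoherator k X).obj F))
  let e₂ := (constShvAdj k X).homEquiv (ModuleCat.of k k) F
  let e₃ : ((constShv k X).obj (ModuleCat.of k k) ⟶
      (qcohInclusion k X).obj ((quasicoherator k X).obj F)) ≃
      ((constShv k X).obj (ModuleCat.of k k) ⟶ F) :=
    (((isQuasicoherentSheaf k X).fullyFaithfulι.homEquiv (X := Q)).symm).trans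
      ((quasicoheratorAdj k X).homEquiv Q F).symm
  refine (congrArg Function.Bijective (funext fun m => ?_)).mpr
    (e₁.symm.trans (e₃.trans e₂)).bijective
  obtain ⟨m, rfl⟩ := e₁.surjective m
  have h : e₃ m = m ≫ (quasicoheratorAdj k X).counit.app F :=
    (quasicoheratorAdj k X).homEquiv_counit Q F ⟨m⟩
  refine Eq.trans ?_ (congrArg (fun m => e₂ (e₃ m)) (e₁.symm_apply_apply m).symm)
  refine Eq.trans ?_ (congrArg e₂ h.symm)
  exact ((constShvAdj k X).homEquiv_naturality_right _ _).symm

variable (k) in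
/-- The counit of the quasi-coherator induces an isomorphism on global sections. -/
noncomputable def quasicoheratorCompGlobalSectionsIso (hX : IsLocallySimplyConnectedSpace X)
    [(qcohInclusion k X).IsLeftAdjoint] :
    quasicoherator k X ⋙ qcGlobalSections k X ≅ globalSections k X :=
  have (F : Shv k X) := isIso_globalSections_map_counit hX F
  NatIso.ofComponents
    (fun F => asIso ((globalSections k X).map ((quasicoheratorAdj k X).counit.app F)))
    fun f => by
      dsimp
      rw [← Functor.map_comp, ← Functor.map_comp]
      exact congrArg _ ((quasicoheratorAdj k X).counit.naturality f)

lemma injective_quasicoherator_obj [IsAbelianSubcategory (isQuasicoherentSheaf k X)]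
    [(qcohInclusion k X).IsLeftAdjoint] (I : Shv k X) (hI : Injective I) :
    Injective ((quasicoherator k X).obj I) :=
  have := preservesMonomorphisms_qcohInclusion (k := k) (X := X)
  Injective.injective_of_adjoint (quasicoheratorAdj k X) I

end CounitGlobalSections

/-! ### Spectral objects and triangulated models of derived functors -/

namespace CategoryTheory.Triangulated.SpectralObject

variable {C ι A : Type*} [Category* C] [Category* ι] [Category* A] [Abelian A] [HasZeroObject C]
  [HasShift C ℤ] [Preadditive C] [∀ n : ℤ, (shiftFunctor C n).Additive] [Pretriangulated C]

/-- The image of a spectral object in a triangulated category by a homological functor. -/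
noncomputable def mapHomologicalFunctor (Y : SpectralObject C ι) (F : C ⥤ A) [F.IsHomological]
    [F.ShiftSequence ℤ] : Abelian.SpectralObject A ι where
  H n := Y.ω₁ ⋙ F.shift n
  δ' n₀ n₁ h :=
    { app D := F.shiftMap (Y.δ'.app D) n₀ n₁ (by rw [add_comm, h])
      naturality D D' f := by
        have := Y.δ'.naturality f
        dsimp at this ⊢
        rw [← F.shiftMap_comp', this, F.shiftMap_comp] }
  exact₁' n₀ n₁ h D :=
    (F.homologySequence_exact₁ _ (Y.distinguished' D) n₀ n₁ h).exact_toComposableArrows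
  exact₂' n D :=
    (F.homologySequence_exact₂ _ (Y.distinguished' D) n).exact_toComposableArrows
  exact₃' n₀ n₁ h D :=
    (F.homologySequence_exact₃ _ (Y.distinguished' D) n₀ n₁ h).exact_toComposableArrows

end CategoryTheory.Triangulated.SpectralObject

lemma CategoryTheory.Functor.exists_isTriangulated_inverse {S T : Type*} [Category* S]
    [Category* T] [HasZeroObject S] [HasZeroObject T] [HasShift S ℤ] [HasShift T ℤ]
    [Preadditive S] [Preadditive T] [∀ n : ℤ, (shiftFunctor S n).Additive]
    [∀ n : ℤ, (shiftFunctor T n).Additive] [Pretriangulated S] [Pretriangulated T] (J : S ⥤ T)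
    [J.CommShift ℤ] [J.IsTriangulated] [J.IsEquivalence] :
    ∃ (J' : T ⥤ S) (_ : J'.CommShift ℤ), J'.IsTriangulated ∧ Nonempty (J' ⋙ J ≅ 𝟭 T) := by
  let adj := J.adjunction
  let _ : J.inv.CommShift ℤ := adj.rightAdjointCommShift ℤ
  have : adj.CommShift ℤ := adj.commShift_of_leftAdjoint ℤ
  exact ⟨J.inv, inferInstance, adj.isTriangulated_rightAdjoint, ⟨J.asEquivalence.counitIso⟩⟩

section InjectiveModel

variable (C : Type*) [Category* C] [Abelian C] [HasDerivedCategory C]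

/-- The functor from the homotopy category of injective objects to the derived category. -/
noncomputable abbrev injectiveToDerivedPlus :
    HomotopyCategory.Plus (InjectiveObject C) ⥤ DerivedCategory.Plus C :=
  (InjectiveObject.ι C).mapHomotopyCategoryPlus ⋙ DerivedCategory.Plus.Qh

/-- A bounded below complex of injectives is K-injective, so homotopy classes of maps into it are
already the maps in the derived category. -/
lemma injectiveToDerivedPlus_map_bijective (K L : HomotopyCategory.Plus (InjectiveObject C)) :
    Function.Bijective ((injectiveToDerivedPlus C).map : (K ⟶ L) → _) := by
  have h₁ : Function.Bijective
      ((InjectiveObject.ι C).mapHomotopyCategoryPlus.map : (K ⟶ L) → _) :=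
    ⟨Functor.map_injective _, Functor.map_surjective _⟩
  have h₂ := DerivedCategory.Plus.Qh_map_bijective_of_isKInjective
    ((InjectiveObject.ι C).mapHomotopyCategoryPlus.obj K)
    ((InjectiveObject.ι C).mapHomotopyCategoryPlus.obj L) (by
      obtain ⟨L, hL⟩ := L
      obtain ⟨L, rfl⟩ := HomotopyCategory.quotient_obj_surjective L
      rw [HomotopyCategory.plus_quotient_obj_iff] at hL
      have (K : CochainComplex.Plus (InjectiveObject C)) : CochainComplex.IsKInjective
        (((InjectiveObject.ι C).mapHomologicalComplex (.up ℤ)).obj K.obj) := inferInstance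
      exact this ⟨L, hL⟩)
  exact h₂.comp h₁

instance : (injectiveToDerivedPlus C).Full where
  map_surjective := (injectiveToDerivedPlus_map_bijective C _ _).2

instance : (injectiveToDerivedPlus C).Faithful where
  map_injective := fun h => (injectiveToDerivedPlus_map_bijective C _ _).1 h

variable [EnoughInjectives C]

instance : (injectiveToDerivedPlus C).IsEquivalence where

variable {C} {D : Type*} [Category* D] [Abelian D] [HasDerivedCategory D]
  (F : C ⥤ D) [F.Additive]

/-- The right derived functor of an additive functor is isomorphic to a triangulated functor. -/
lemma CategoryTheory.Functor.exists_rightDerivedFunctorPlus_iso :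
    ∃ (G : DerivedCategory.Plus C ⥤ DerivedCategory.Plus D) (_ : G.CommShift ℤ),
      G.IsTriangulated ∧ Nonempty (F.rightDerivedFunctorPlus ≅ G) := by
  -- The model applies `F` termwise to an injective replacement; it is triangulated as a composite
  -- of triangulated functors.
  let J' : HomotopyCategory.Plus (InjectiveObject C) ⥤ DerivedCategory.Plus D :=
    (InjectiveObject.ι C).mapHomotopyCategoryPlus ⋙ F.mapHomotopyCategoryPlus ⋙
      DerivedCategory.Plus.Qh
  obtain ⟨I, _, _, ⟨e⟩⟩ := (injectiveToDerivedPlus C).exists_isTriangulated_inverse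
  let α : J' ⟶ injectiveToDerivedPlus C ⋙ F.rightDerivedFunctorPlus :=
    Functor.whiskerLeft (InjectiveObject.ι C).mapHomotopyCategoryPlus F.rightDerivedFunctorPlusUnit
  have (K : HomotopyCategory.Plus (InjectiveObject C)) : IsIso (α.app K) :=
    inferInstanceAs (IsIso (F.rightDerivedFunctorPlusUnit.app
      ((InjectiveObject.ι C).mapHomotopyCategoryPlus.obj K)))
  have : IsIso α := NatIso.isIso_of_isIso_app α
  refine ⟨I ⋙ J', inferInstance, inferInstance, ⟨?_⟩⟩
  exact (Functor.leftUnitor _).symm ≪≫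
    Functor.isoWhiskerRight e.symm F.rightDerivedFunctorPlus ≪≫
    Functor.associator _ _ _ ≪≫ Functor.isoWhiskerLeft I (asIso α).symm

end InjectiveModel

/-! ### Convergence for bounded below spectral objects -/

namespace CategoryTheory.Abelian

/-- The quotient of the image of `u` by the image of `v` is the object through which the
composition of `u` with the cokernel of `v` factors. -/
lemma nonempty_cokernel_imageSubobject_iso {A : Type*} [Category* A] [Abelian A]
    {A₀ A₁ H B E : A} (v : A₀ ⟶ H) (u : A₁ ⟶ H) (w : H ⟶ B) (zero : v ≫ w = 0)
    (hvw : (ShortComplex.mk v w zero).Exact) (e : A₁ ⟶ E) (m : E ⟶ B) [Epi e] [Mono m]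
    (fac : e ≫ m = u ≫ w) (h : imageSubobject v ≤ imageSubobject u) :
    Nonempty (E ≅ cokernel (Subobject.ofLE _ _ h)) := by
  have hw : imageSubobject v = kernelSubobject w := (ShortComplex.exact_iff_image_eq_kernel _).1 hvw
  have zero' : Subobject.ofLE _ _ h ≫ (imageSubobject u).arrow ≫ w = 0 := by
    rw [Subobject.ofLE_arrow_assoc, ← cancel_epi (factorThruImageSubobject v),
      imageSubobject_arrow_comp_assoc, comp_zero, zero]
  have ex : (ShortComplex.mk _ _ zero').Exact := by
    refine ShortComplex.exact_of_f_is_kernel _ (KernelFork.IsLimit.ofι' _ _ fun {T} t ht => ?_)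
    have ht' : (imageSubobject v).Factors (t ≫ (imageSubobject u).arrow) :=
      hw.symm.subst (motive := fun S => S.Factors (t ≫ (imageSubobject u).arrow))
        (kernelSubobject_factors w _ (by simpa using ht))
    refine ⟨(imageSubobject v).factorThru _ ht', ?_⟩
    rw [← cancel_mono (imageSubobject u).arrow, Category.assoc, Subobject.ofLE_arrow,
      Subobject.factorThru_arrow]
  have : Mono (cokernel.desc _ _ zero') := (ShortComplex.exact_iff_mono_cokernel_desc _).1 ex
  have fac' : (factorThruImageSubobject u ≫ cokernel.π (Subobject.ofLE _ _ h)) ≫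
      cokernel.desc _ _ zero' = u ≫ w := by
    rw [Category.assoc, cokernel.π_desc, imageSubobject_arrow_comp_assoc]
  have : Epi (factorThruImageSubobject u ≫ cokernel.π (Subobject.ofLE _ _ h)) := epi_comp _ _
  have := strongEpi_of_epi e
  have := strongEpi_of_epi (factorThruImageSubobject u ≫ cokernel.π (Subobject.ofLE _ _ h))
  -- Both objects are the image of `u ≫ w`.
  exact ⟨image.isoStrongEpiMono e m fac ≪≫ (image.isoStrongEpiMono _ _ fac').symm⟩

lemma imageSubobject_le_of_fac {A : Type*} [Category* A] [Abelian A] {X Y Z : A} {f : X ⟶ Z}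
    {g : Y ⟶ Z} {t : X ⟶ Y} (h : t ≫ g = f) : imageSubobject f ≤ imageSubobject g := by
  subst h
  exact imageSubobject_comp_le _ _

lemma imageSubobject_eq_top_of_epi {A : Type*} [Category* A] [Abelian A] {X Y : A} (f : X ⟶ Y)
    [Epi f] : imageSubobject f = ⊤ := by
  have : Epi (imageSubobject f).arrow := by
    have : Epi (factorThruImageSubobject f ≫ (imageSubobject f).arrow) := by
      rw [imageSubobject_arrow_comp]
      infer_instance
    exact epi_of_epi (factorThruImageSubobject f) _
  have : IsIso (imageSubobject f).arrow := isIso_of_mono_of_epi _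
  exact Subobject.eq_top_of_isIso_arrow _

lemma imageSubobject_eq_bot {A : Type*} [Category* A] [Abelian A] {X Y : A} {f : X ⟶ Y}
    (h : f = 0) : imageSubobject f = ⊥ := by
  subst h
  exact imageSubobject_zero

namespace SpectralObject

open ComposableArrows

variable {A : Type u} [Category.{v} A] [Abelian A] (Y : SpectralObject A EInt)

/-- The map to `Hⁿ(⊥ ≤ ⊤)` whose image is a step of the filtration. -/
noncomputable def filtrationMap (n : ℤ) (j : EInt) :
    (Y.H n).obj (mk₁ (homOfLE bot_le : ⊥ ⟶ j)) ⟶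
      (Y.H n).obj (mk₁ (homOfLE bot_le : ⊥ ⟶ (⊤ : EInt))) :=
  (Y.H n).map (twoδ₂Toδ₁ (homOfLE bot_le) (homOfLE le_top) _ rfl)

lemma filtrationMap_fac (n : ℤ) {i j : EInt} (h : i ≤ j) :
    (Y.H n).map (twoδ₂Toδ₁ (homOfLE bot_le) (homOfLE h) _ rfl) ≫ Y.filtrationMap n j =
      Y.filtrationMap n i := by
  rw [filtrationMap, filtrationMap, ← Functor.map_comp]
  congr 1

/-- A spectral object indexed by extended integers is bounded below by `a` if
`Hⁿ(i ≤ j)` vanishes for `n < i` and for `j ≤ a`. -/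
structure IsBoundedBelow (a : ℤ) : Prop where
  isZero_of_lt {n : ℤ} {i j : EInt} (f : i ⟶ j) (h : ((n + 1 : ℤ) : EInt) ≤ i) :
    IsZero ((Y.H n).obj (mk₁ f))
  isZero_of_le (n : ℤ) {i j : EInt} (f : i ⟶ j) (h : j ≤ (a : ℤ)) :
    IsZero ((Y.H n).obj (mk₁ f))

variable {Y} {a : ℤ} (hY : Y.IsBoundedBelow a) {H : ℤ → A}
  (e : ∀ n, H n ≅ (Y.H n).obj (mk₁ (homOfLE bot_le : ⊥ ⟶ (⊤ : EInt))))

include hY in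
-- The outer indices can be pushed to `⊥` and `⊤` because `Hⁿ⁺¹(⊥ ≤ b)` and `Hⁿ⁻¹(c ≤ ⊤)` vanish.
lemma IsBoundedBelow.nonempty_E_iso (n : ℤ) {b i j c : EInt} (hbi : b ≤ i) (hij : i ≤ j)
    (hjc : j ≤ c) (hb : b ≤ (a : ℤ)) (hc : ((n : ℤ) : EInt) ≤ c) :
    Nonempty (Y.E (homOfLE hbi) (homOfLE hij) (homOfLE hjc) (n - 1) n (n + 1) ≅
      Y.E (homOfLE (bot_le : ⊥ ≤ i)) (homOfLE hij) (homOfLE (le_top : j ≤ ⊤)) (n - 1) n (n + 1)) :=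
  ⟨(Y.isoMapFourδ₁Toδ₀' ⊥ b i j c bot_le hbi hij hjc (n - 1) n (n + 1)
      (hY.isZero_of_le _ _ hb)).symm ≪≫
    Y.isoMapFourδ₄Toδ₃' ⊥ i j c ⊤ bot_le hij hjc le_top (n - 1) n (n + 1)
      (hY.isZero_of_lt _ (by simpa using hc))⟩

/-- The left side is the image of `Hⁿ(⊥ ≤ j) → Hⁿ(⊥ ≤ ⊤) → Hⁿ(i ≤ ⊤)`, and the kernel of the second
map is the image of `Hⁿ(⊥ ≤ i)`. -/
lemma nonempty_E_iso_cokernel (n : ℤ) {i j : EInt} (hij : i ≤ j)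
    (h : imageSubobject (Y.filtrationMap n i ≫ (e n).inv) ≤
      imageSubobject (Y.filtrationMap n j ≫ (e n).inv)) :
    Nonempty (Y.E (homOfLE (bot_le : ⊥ ≤ i)) (homOfLE hij) (homOfLE (le_top : j ≤ ⊤))
      (n - 1) n (n + 1) ≅ cokernel (Subobject.ofLE _ _ h)) := by
  let f₁ : (⊥ : EInt) ⟶ i := homOfLE bot_le
  let f₂ : i ⟶ j := homOfLE hij
  let f₃ : j ⟶ ⊤ := homOfLE le_top
  let f₂₃ : i ⟶ ⊤ := homOfLE le_top
  let f₁₂ : ⊥ ⟶ j := homOfLE bot_le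
  let w := (Y.H n).map (twoδ₁Toδ₀ f₁ f₂₃ (homOfLE bot_le) rfl)
  have zero : (Y.filtrationMap n i ≫ (e n).inv) ≫ (e n).hom ≫ w = 0 := by
    rw [Category.assoc, Iso.inv_hom_id_assoc]
    exact Y.zero₂ f₁ f₂₃ _ rfl n
  refine nonempty_cokernel_imageSubobject_iso _ _ ((e n).hom ≫ w) zero ?_
    (Y.toCycles f₁ f₂ f₁₂ rfl n ≫ Y.πE f₁ f₂ f₃ (n - 1) n (n + 1))
    (Y.ιE f₁ f₂ f₃ (n - 1) n (n + 1) ≫ Y.fromOpcycles f₂ f₃ f₂₃ rfl n) ?_ h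
  · refine (ShortComplex.exact_iff_of_iso ?_).1 (Y.exact₂ f₁ f₂₃ (homOfLE bot_le) rfl n)
    exact ShortComplex.isoMk (Iso.refl _) (e n).symm (Iso.refl _)
      (Category.id_comp _)
      (((e n).inv_hom_id_assoc w).trans (Category.comp_id w).symm)
  · rw [Category.assoc, Category.assoc, Iso.inv_hom_id_assoc, Y.πE_ιE_assoc .., Y.p_fromOpcycles,
      Y.toCycles_i_assoc, filtrationMap, ← Functor.map_comp, ← Functor.map_comp]
    congr 1

include hY e in
/-- The convergence of the `E₂`-spectral sequence of a bounded below spectral object. -/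
lemma IsBoundedBelow.nonempty_convergence :
    Nonempty (SpectralSequenceConvergence Y.E₂SpectralSequence H) := by
  -- `F^p Hⁿ` is the image of `Hⁿ(⊥ ≤ n - p + 1)`. For `n = p + q`, consecutive indices are `q` and
  -- `q + 1`, those of the `E₂` term.
  have h_le (n p : ℤ) : imageSubobject (Y.filtrationMap n ((n - (p + 1) + 1 : ℤ) : EInt) ≫
      (e n).inv) ≤ imageSubobject (Y.filtrationMap n ((n - p + 1 : ℤ) : EInt) ≫ (e n).inv) := by
    have h := Y.filtrationMap_fac n (show ((n - (p + 1) + 1 : ℤ) : EInt) ≤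
      ((n - p + 1 : ℤ) : EInt) by simp; lia)
    exact imageSubobject_le_of_fac
      ((Category.assoc _ _ _).symm.trans (congrArg (· ≫ (e n).inv) h))
  -- The term at `(p, q)` on page `r` has indices `q - r + 2 ≤ q ≤ q + 1 ≤ q + r - 1`. The bound `q
  -- + 2 - a` brings the first index below `a` and kills the target of the outgoing differential; `p
  -- + 2` (already `p + 1` would do) handles the last index and the source of the incoming one.
  let stage (p q : ℤ) : ℤ := max 2 (max (q + 2 - a) (p + 2))
  have h_stage (p q r : ℤ) (hr : stage p q ≤ r) : 2 ≤ r ∧ q - r + 2 ≤ a ∧ p + 2 ≤ r := by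
    simp only [stage, max_le_iff] at hr
    omega
  have h_iso (p q : ℤ) :
      Nonempty ((Y.E₂SpectralSequence.page (stage p q) (h_stage p q _ le_rfl).1).X (p, q) ≅
        cokernel (Subobject.ofLE _ _ (h_le (p + q) p))) := by
    obtain ⟨h₁, h₂, h₃⟩ := h_stage p q _ le_rfl
    have hb : ((q - stage p q + 2 : ℤ) : EInt) ≤ (a : ℤ) := by simpa using h₂
    have hc : ((p + q : ℤ) : EInt) ≤ ((q + stage p q - 1 : ℤ) : EInt) := by simp; lia
    obtain ⟨e₁⟩ := hY.nonempty_E_iso (p + q) (i := (p + q - (p + 1) + 1 : ℤ))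
      (j := (p + q - p + 1 : ℤ)) (by simp; lia) (by simp) (by simp; lia) hb hc
    obtain ⟨e₂⟩ := nonempty_E_iso_cokernel e (p + q) _ (h_le (p + q) p)
    exact ⟨Y.spectralSequencePageXIso coreE₂Cohomological _ h₁ (p, q) _ _ _ _ rfl
      (by simp) (by simp) rfl (p + q - 1) (p + q) (p + q + 1) rfl ≪≫ e₁ ≪≫ e₂⟩
  refine ⟨{
    fil n p := imageSubobject (Y.filtrationMap n ((n - p + 1 : ℤ) : EInt) ≫ (e n).inv)
    fil_succ_le := h_le
    -- At `p = 0` the cokernel lies in `Hⁿ(n + 1 ≤ ⊤) = 0`; at `p = n + 1 - a` the source is `Hⁿ(⊥ ≤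
    -- a) = 0`.
    exists_eq_top n := ⟨0, ?_⟩
    exists_eq_bot n := ⟨n + 1 - a, ?_⟩
    stage := stage
    two_le_stage p q := (h_stage p q _ le_rfl).1
    d_from_eq_zero p q r hr pq' := ?_
    d_to_eq_zero p q r hr pq' := ?_
    iso p q := (h_iso p q).some }⟩
  · have : Epi (Y.filtrationMap n ((n - 0 + 1 : ℤ) : EInt)) :=
      (Y.exact₂ _ _ _ rfl n).epi_f ((hY.isZero_of_lt _ (by simp)).eq_of_tgt _ _)
    exact imageSubobject_eq_top_of_epi _
  · have : Y.filtrationMap n ((n - (n + 1 - a) + 1 : ℤ) : EInt) = 0 :=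
      (hY.isZero_of_le n _ (by simp; lia)).eq_of_src _ _
    exact imageSubobject_eq_bot (by rw [this, zero_comp])
  · obtain ⟨h₁, h₂, h₃⟩ := h_stage p q r hr
    by_cases h : (ComplexShape.up' (⟨r, 1 - r⟩ : ℤ × ℤ)).Rel (p, q) pq'
    · obtain rfl := h
      refine IsZero.eq_of_tgt ?_ _ _
      refine Y.isZero_spectralSequence_page_X_of_isZero_H' coreE₂Cohomological r h₁ _ ?_
      exact hY.isZero_of_le _ _ (by simp; lia)
    · exact HomologicalComplex.shape _ _ _ h
  · obtain ⟨h₁, h₂, h₃⟩ := h_stage p q r hr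
    by_cases h : (ComplexShape.up' (⟨r, 1 - r⟩ : ℤ × ℤ)).Rel pq' (p, q)
    · refine IsZero.eq_of_src ?_ _ _
      refine Y.isZero_spectralSequence_page_X_of_isZero_H' coreE₂Cohomological r h₁ _ ?_
      have h₄ := congrArg _root_.Prod.fst h
      have h₅ := congrArg _root_.Prod.snd h
      dsimp at h₄ h₅
      exact hY.isZero_of_lt _ (by simp; lia)
    · exact HomologicalComplex.shape _ _ _ h

end SpectralObject

end CategoryTheory.Abelian

/-! ### Truncations in the bounded below derived category -/

section HomologicalFunctor

open Pretriangulated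

variable {C A : Type*} [Category* C] [Category* A] [Abelian A] [HasZeroObject C]
  [HasShift C ℤ] [Preadditive C] [∀ n : ℤ, (shiftFunctor C n).Additive] [Pretriangulated C]
  (F : C ⥤ A) [F.IsHomological] {T : Triangle C}

lemma CategoryTheory.Functor.isIso_map_mor₂ (hT : T ∈ distTriang C)
    (h₁ : IsZero (F.obj T.obj₁)) (h₂ : IsZero (F.obj (T.obj₁⟦(1 : ℤ)⟧))) :
    IsIso (F.map T.mor₂) := by
  have : Mono (F.map T.mor₂) := (F.map_distinguished_exact _ hT).mono_g (h₁.eq_of_src _ _)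
  have : Epi (F.map T.mor₂) := (F.map_distinguished_exact _
    (rot_of_distTriang _ hT)).epi_f (h₂.eq_of_tgt _ _)
  exact isIso_of_mono_of_epi _

lemma CategoryTheory.Functor.isIso_map_mor₁ (hT : T ∈ distTriang C)
    (h₁ : IsZero (F.obj T.obj₃)) (h₂ : IsZero (F.obj (T.obj₃⟦(-1 : ℤ)⟧))) :
    IsIso (F.map T.mor₁) := by
  have : Epi (F.map T.mor₁) := (F.map_distinguished_exact _ hT).epi_f (h₁.eq_of_tgt _ _)
  have : Mono (F.map T.mor₁) := (F.map_distinguished_exact _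
    (inv_rot_of_distTriang _ hT)).mono_g (h₂.eq_of_src _ _)
  exact isIso_of_mono_of_epi _

end HomologicalFunctor

namespace DerivedCategory.Plus

variable {C : Type*} [Category* C] [Abelian C] [HasDerivedCategory C]

lemma nonempty_homologyFunctor_shift_iso (X : Plus C) (a p q : ℤ) (h : a + p = q) :
    Nonempty ((homologyFunctor C p).obj (X⟦a⟧) ≅ (homologyFunctor C q).obj X) :=
  ⟨(((homologyFunctor C 0).shiftIso a p q h).app X)⟩

lemma isIso_homologyFunctor_map_truncGEπ (X : Plus C) (n : ℤ) :
    IsIso ((homologyFunctor C n).map ((TStructure.t.truncGEπ n).app X)) := by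
  have hT := TStructure.t.triangleLTGE_distinguished n X
  have h₁ : IsLE ((TStructure.t.truncLT n).obj X) (n - 1) := inferInstance
  have h₂ : IsLE (((TStructure.t.truncLT n).obj X)⟦(1 : ℤ)⟧) (n - 2) :=
    TStructure.t.isLE_shift _ (n - 1) 1 (n - 2)
  have h₃ := isZero_homology_of_isLE ((TStructure.t.truncLT n).obj X) (n - 1) n (by lia)
  have h₄ := isZero_homology_of_isLE (((TStructure.t.truncLT n).obj X)⟦(1 : ℤ)⟧) (n - 2) n (by lia)
  exact (homologyFunctor C n).isIso_map_mor₂ hT h₃ h₄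

lemma isIso_homologyFunctor_map_truncLTι (X : Plus C) (n m : ℤ) (h : n + 1 = m) :
    IsIso ((homologyFunctor C n).map ((TStructure.t.truncLTι m).app X)) := by
  have hT := TStructure.t.triangleLTGE_distinguished m X
  have h₁ : IsGE ((TStructure.t.truncGE m).obj X) m := inferInstance
  have h₂ : IsGE (((TStructure.t.truncGE m).obj X)⟦(-1 : ℤ)⟧) (m + 1) :=
    TStructure.t.isGE_shift _ m (-1) (m + 1)
  have h₃ := isZero_homology_of_isGE ((TStructure.t.truncGE m).obj X) m n (by lia)
  have h₄ := isZero_homology_of_isGE (((TStructure.t.truncGE m).obj X)⟦(-1 : ℤ)⟧) (m + 1) n (by lia)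
  exact (homologyFunctor C n).isIso_map_mor₁ hT h₃ h₄

lemma nonempty_iso_singleFunctor_obj (X : Plus C) (n : ℤ) [X.IsGE n] [X.IsLE n] :
    Nonempty (X ≅ (singleFunctor C n).obj ((homologyFunctor C n).obj X)) := by
  obtain ⟨Y, ⟨e⟩⟩ := (ι.obj X).exists_iso_singleFunctor_obj_of_isGE_of_isLE n
  have e' : (homologyFunctor C n).obj X ≅ Y :=
    (DerivedCategory.homologyFunctor C n).mapIso e ≪≫
      (DerivedCategory.singleFunctorCompHomologyFunctorIso C n).app Y
  let e'' : X ≅ (singleFunctor C n).obj Y := ι.preimageIso (Y := (singleFunctor C n).obj Y) e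
  exact ⟨e'' ≪≫ (singleFunctor C n).mapIso e'.symm⟩

/-- The slice of `X` between consecutive truncations has only the cohomology of `X` in degree `n`.
This identifies the `E₂` terms. -/
lemma nonempty_iso_shift_singleFunctor_obj (X : Plus C) (n : ℤ) :
    Nonempty ((TStructure.t.truncGE n).obj ((TStructure.t.truncLT (n + 1)).obj X) ≅
      ((singleFunctor C 0).obj ((homologyFunctor C n).obj X))⟦-n⟧) := by
  have h₁ : IsLE ((TStructure.t.truncLT (n + 1)).obj X) n :=
    TStructure.t.isLE_of_le _ (n + 1 - 1) n
  have h₂ : IsLE ((TStructure.t.truncGE n).obj ((TStructure.t.truncLT (n + 1)).obj X)) n :=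
    inferInstance
  obtain ⟨e⟩ := nonempty_iso_singleFunctor_obj
    ((TStructure.t.truncGE n).obj ((TStructure.t.truncLT (n + 1)).obj X)) n
  have := isIso_homologyFunctor_map_truncGEπ ((TStructure.t.truncLT (n + 1)).obj X) n
  have := isIso_homologyFunctor_map_truncLTι X n _ rfl
  have e' : (homologyFunctor C n).obj
      ((TStructure.t.truncGE n).obj ((TStructure.t.truncLT (n + 1)).obj X)) ≅
        (homologyFunctor C n).obj X :=
    (asIso ((homologyFunctor C n).map
      ((TStructure.t.truncGEπ n).app ((TStructure.t.truncLT (n + 1)).obj X)))).symm ≪≫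
      asIso ((homologyFunctor C n).map ((TStructure.t.truncLTι (n + 1)).app X))
  exact ⟨e ≪≫ (singleFunctor C n).mapIso e' ≪≫
    (((singleFunctors C).shiftIso (-n) n 0 (by lia)).app _).symm⟩

end DerivedCategory.Plus

/-! ### The Grothendieck spectral sequence -/

namespace CategoryTheory.Functor

variable {C D : Type*} [Category* C] [Category* D] [Abelian C] [Abelian D]
  [HasDerivedCategory C] [HasDerivedCategory D] [EnoughInjectives C]
  (F : C ⥤ D) [F.Additive]

open _root_.DerivedCategory

/-- The derived functor may be computed on an injective complex that starts in degree `n`. -/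
lemma isGE_rightDerivedFunctorPlus_obj (K : DerivedCategory.Plus C) (n : ℤ) [K.IsGE n] :
    (F.rightDerivedFunctorPlus.obj K).IsGE n := by
  obtain ⟨L, _, ⟨e⟩⟩ := Plus.exists_injective_nonempty_iso K n
  let K' := (HomotopyCategory.Plus.quotient C).obj
    ((InjectiveObject.ι C).mapCochainComplexPlus.obj L)
  have : IsIso (F.rightDerivedFunctorPlusUnit.app K') := inferInstance
  let e' : Plus.Qh.obj (F.mapHomotopyCategoryPlus.obj K') ≅ F.rightDerivedFunctorPlus.obj K :=
    asIso (F.rightDerivedFunctorPlusUnit.app K') ≪≫ F.rightDerivedFunctorPlus.mapIso e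
  let M : CochainComplex D ℤ := (F.mapHomologicalComplex (.up ℤ)).obj
    (((InjectiveObject.ι C).mapHomologicalComplex (.up ℤ)).obj L.obj)
  have : M.IsStrictlyGE n := inferInstance
  have : (Plus.Qh.obj (F.mapHomotopyCategoryPlus.obj K')).IsGE n := by
    rw [← Plus.isGE_ι_obj_iff]
    exact DerivedCategory.TStructure.t.isGE_of_iso
      ((quotientCompQhIso D).symm.app M) n
  exact Plus.TStructure.t.isGE_of_iso e' n

end CategoryTheory.Functor

namespace CategoryTheory.Functor

open _root_.DerivedCategory

/-- The Grothendieck spectral sequence of a derived functor. -/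
theorem exists_spectralSequence {C : Type*} [Category* C] [Abelian C]
    [EnoughInjectives C] [HasDerivedCategory.{w₃} C] (k : Type u) [Ring k]
    [HasDerivedCategory.{w₂} (ModuleCat.{u} k)] (F : C ⥤ ModuleCat.{u} k) [F.Additive]
    (L : DerivedCategory.Plus C) :
    ∃ E : E₂CohomologicalSpectralSequence (ModuleCat.{u} k),
      (∀ p q : ℤ, Nonempty ((E.page 2 le_rfl).X (p, q) ≅
        (DerivedCategory.Plus.homologyFunctor (ModuleCat.{u} k) p).obj
          (F.rightDerivedFunctorPlus.obj ((DerivedCategory.Plus.singleFunctor C 0).obj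
            ((DerivedCategory.Plus.homologyFunctor C q).obj L))))) ∧
      ∀ H : ℤ → ModuleCat.{u} k, (∀ n, Nonempty (H n ≅
        (DerivedCategory.Plus.homologyFunctor (ModuleCat.{u} k) n).obj
          (F.rightDerivedFunctorPlus.obj L))) → Nonempty (SpectralSequenceConvergence E H) := by
  obtain ⟨G, _, _, ⟨e⟩⟩ := F.exists_rightDerivedFunctorPlus_iso
  have hG (K : DerivedCategory.Plus C) (n : ℤ) [K.IsGE n] : (G.obj K).IsGE n := by
    have := F.isGE_rightDerivedFunctorPlus_obj K n
    exact Plus.TStructure.t.isGE_of_iso (e.app K) n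
  obtain ⟨a, ha⟩ := L.property
  have : L.IsGE a := (Plus.isGE_ι_obj_iff L a).1 ha
  -- `Y` sends `i ≤ j` to the cohomology of `G(τ_{≥ i} τ_{< j} L)`. It vanishes in degrees below `i`
  -- since `G` is left t-exact, and for `j ≤ a` since `τ_{< j} L = 0`.
  let Y : Abelian.SpectralObject (ModuleCat.{u} k) EInt :=
    ((Plus.TStructure.t.spectralObject L).mapTriangulatedFunctor G).mapHomologicalFunctor
      (Plus.homologyFunctor (ModuleCat.{u} k) 0)
  have hY : Y.IsBoundedBelow a :=
    { isZero_of_lt := fun {n i j} f h => by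
        have := Plus.TStructure.t.isGE_eTruncGE_obj_obj (n + 1) i h
          ((Plus.TStructure.t.eTruncLT.obj j).obj L)
        have := hG ((Plus.TStructure.t.eTruncGE.obj i).obj
          ((Plus.TStructure.t.eTruncLT.obj j).obj L)) (n + 1)
        have h' := Plus.isZero_homology_of_isGE (G.obj ((Plus.TStructure.t.eTruncGE.obj i).obj
          ((Plus.TStructure.t.eTruncLT.obj j).obj L))) (n + 1) n (by lia)
        exact h'
      isZero_of_le := fun n {i j} f h => by
        have h₁ := Plus.TStructure.t.isZero_eTruncLT_obj_obj L a j h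
        have h₂ := G.map_isZero ((Plus.TStructure.t.eTruncGE.obj i).map_isZero h₁)
        exact (Plus.homologyFunctor (ModuleCat.{u} k) n).map_isZero h₂ }
  refine ⟨Y.E₂SpectralSequence, fun p q => ?_, fun H hH => ?_⟩
  · obtain ⟨e₁⟩ := Plus.nonempty_iso_shift_singleFunctor_obj L q
    -- The shift by `-q` turns total degree `p + q` into degree `p`.
    obtain ⟨e₂⟩ := Plus.nonempty_homologyFunctor_shift_iso
      (G.obj ((Plus.singleFunctor C 0).obj ((Plus.homologyFunctor C q).obj L)))
        (-q) (p + q) p (by lia)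
    exact ⟨Y.spectralSequenceFirstPageXIso Abelian.SpectralObject.coreE₂Cohomological (p, q)
      q (q + 1 : ℤ) rfl rfl (p + q) rfl ≪≫
      (Plus.homologyFunctor _ (p + q)).mapIso
        (G.mapIso e₁ ≪≫ (G.commShiftIso (-q)).app _) ≪≫ e₂ ≪≫
      (Plus.homologyFunctor _ p).mapIso (e.app _).symm⟩
  · exact hY.nonempty_convergence fun n => (hH n).some ≪≫
      (Plus.homologyFunctor _ n).mapIso (e.app L)

end CategoryTheory.Functor

theorem mainTheorem8 (k : Type u) [Ring k] (X : TopCat.{u}) [ConnectedSpace X]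
    (hX : IsLocallySimplyConnectedSpace X)
    [HasDerivedCategory.{w₁} (Shv k X)] [HasDerivedCategory.{w₂} (ModuleCat.{u} k)] :
    -- the objects in the statement exist
    ∃ (_ : IsAbelianSubcategory (isQuasicoherentSheaf k X))
      (_ : EnoughInjectives (Qcoh k X))
      (_ : (qcohInclusion k X).IsLeftAdjoint),
    ∀ [HasDerivedCategory.{w₃} (Qcoh k X)],
      -- the natural isomorphism, compatible with the units of the derived functors
      (∃ (e₀ : quasicoherator k X ⋙ qcGlobalSections k X ≅ globalSections k X)
          (e : RΓ k X ≅ RQc k X ⋙ RqcΓ k X),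
        (∀ F : Shv k X, e₀.hom.app F =
          (globalSections k X).map ((quasicoheratorAdj k X).counit.app F)) ∧
        ∀ K : HomotopyCategory.Plus (Shv k X),
          (globalSections k X).rightDerivedFunctorPlusUnit.app K ≫
              e.hom.app (DerivedCategory.Plus.Qh.obj K) =
            DerivedCategory.Plus.Qh.map
                ((Functor.mapHomotopyCategoryPlusCompIso e₀).inv.app K) ≫
              (qcGlobalSections k X).rightDerivedFunctorPlusUnit.app
                ((quasicoherator k X).mapHomotopyCategoryPlus.obj K) ≫
              (RqcΓ k X).map ((quasicoherator k X).rightDerivedFunctorPlusUnit.app K)) ∧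
      -- the convergent spectral sequence
      (∀ F : DerivedCategory.Plus (Shv k X),
        ∃ E : E₂CohomologicalSpectralSequence (ModuleCat.{u} k),
          (∀ p q : ℤ, Nonempty ((E.page 2 le_rfl).X (p, q) ≅
            qcCohomology k X p (derivedQc k X q F))) ∧
          Nonempty (SpectralSequenceConvergence E fun n => sheafCohomology k X n F)) := by
  have hQ := isAbelianSubcategory_isQuasicoherentSheaf (k := k) hX
  have hL := isLeftAdjoint_qcohInclusion (k := k) hX
  have hI := enoughInjectives_qcoh (k := k) (X := X)
  refine ⟨hQ, hI, hL, ?_⟩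
  intro _
  let e₀ := quasicoheratorCompGlobalSectionsIso k hX
  have := Functor.isIso_rightDerivedFunctorPlusCompHom e₀ injective_quasicoherator_obj
  let e : RΓ k X ≅ RQc k X ⋙ RqcΓ k X := asIso (Functor.rightDerivedFunctorPlusCompHom e₀)
  refine ⟨⟨e₀, e, fun F => rfl, fun K => Functor.rightDerivedFunctorPlusCompHom_fac e₀ K⟩,
    fun F => ?_⟩
  -- Applied to RQc(`F`), the abutment is identified with sheaf cohomology by `e`.
  obtain ⟨E, h₁, h₂⟩ := (qcGlobalSections k X).exists_spectralSequence k ((RQc k X).obj F)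
  exact ⟨E, h₁, h₂ _ fun n => ⟨(DerivedCategory.Plus.homologyFunctor _ n).mapIso (e.app F)⟩⟩
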